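/- Let $d \geq 2$. A walk of length $n$ is a map $\gamma : \{0, \dots, n\} \to \mathbb{Z}^d$ such that $\gamma_i$ and $\gamma_{i+1}$ are nearest neighbours in $\mathbb{Z}^d$ for every $0 \leq i < n$; it is self-avoiding if it is injective. Let $\mathrm{SAW}_n$ be the (finite, non-empty) set of self-avoiding walks of length $n$ with $\gamma_0 = 0$, let $\mathsf{P}_{\mathrm{SAW}_n}$ be the uniform probability measure on $\mathrm{SAW}_n$, and let $\Gamma$ denote a walk with this law. Then there exists a constant $C > 0$ (which may depend on $d$) such that, for every integer $n \geq 1$, $$\sup_{x \in \mathbb{Z}^d} \mathsf{P}_{\mathrm{SAW}_n}\left(\Gamma_{\lfloor n/2 \rfloor} = x\right) \leq C\, n^{-1/2}.$$ -/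

import Mathlib

open MeasureTheory ProbabilityTheory

namespace SelfAvoidingWalk

/-- The integer lattice `ℤ^d` with its nearest-neighbour bonds: `x` and `y` are joined by a bond
exactly when their difference is plus or minus a standard basis vector, that is, when
`∑ i, |x i - y i| = 1`. -/
def lattice (d : ℕ) : SimpleGraph (Fin d → ℤ) where
  Adj x y := ∑ i, |x i - y i| = 1
  symm := ⟨fun x y h => by simpa only [abs_sub_comm] using h⟩
  loopless := ⟨fun x h => by simp at h⟩

/-- The set of self-avoiding walks of length `n` in `ℤ^d` that start at `0`: the injective maps
`γ : {0, …, n} → ℤ^d` with `γ 0 = 0` all of whose steps are nearest-neighbour bonds. -/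
def SAW (d n : ℕ) : Set (Fin (n + 1) → Fin d → ℤ) :=
  {γ | γ 0 = 0 ∧ (∀ i : Fin n, (lattice d).Adj (γ i.castSucc) (γ i.succ)) ∧
    Function.Injective γ}

/-- The uniform law on the self-avoiding walks of length `n` in `ℤ^d` that start at `0`. -/
noncomputable def PSAW (d n : ℕ) : Measure (Fin (n + 1) → Fin d → ℤ) :=
  uniformOn (SAW d n)

theorem abs_coord_le {d n : ℕ} {γ : Fin (n + 1) → Fin d → ℤ} (hγ : γ ∈ SAW d n)
    (i : Fin (n + 1)) (j : Fin d) : |γ i j| ≤ (i : ℕ) := by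
  induction i using Fin.induction with
  | zero => simp [hγ.1]
  | succ i ih =>
    have h1 : ∑ k, |γ i.castSucc k - γ i.succ k| = 1 := hγ.2.1 i
    have h2 : |γ i.castSucc j - γ i.succ j| ≤ 1 := by
      rw [← h1]
      exact Finset.single_le_sum (f := fun k => |γ i.castSucc k - γ i.succ k|)
        (fun k _ => abs_nonneg _) (Finset.mem_univ j)
    simp only [Fin.val_castSucc, Fin.val_succ] at ih ⊢
    push_cast
    rw [abs_le] at *
    omega

theorem finite_SAW (d n : ℕ) : (SAW d n).Finite := by
  refine Set.Finite.subset
    (Set.Finite.pi' fun _ => Set.Finite.pi' fun _ => Set.finite_Icc (-(n : ℤ)) n) ?_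
  intro γ hγ i j
  have h := abs_coord_le hγ i j
  have hi := i.isLt
  rw [abs_le] at h
  rw [Set.mem_Icc]
  omega

theorem nonempty_SAW {d : ℕ} (hd : 0 < d) (n : ℕ) : (SAW d n).Nonempty := by
  refine ⟨fun i => Pi.single ⟨0, hd⟩ ((i : ℕ) : ℤ), ?_, ?_, ?_⟩
  · simp
  · intro i
    change ∑ k, |_ - _| = (1 : ℤ)
    rw [Finset.sum_eq_single ⟨0, hd⟩]
    · simp
    · intro k _ hk
      simp [Pi.single_eq_of_ne hk]
    · simp
  · intro i j h
    have := congrFun h ⟨0, hd⟩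
    simpa [Fin.ext_iff] using this

/-- `PSAW d n` is a probability measure. -/
theorem isProbabilityMeasure_PSAW {d : ℕ} (hd : 0 < d) (n : ℕ) :
    IsProbabilityMeasure (PSAW d n) :=
  isProbabilityMeasure_uniformOn (finite_SAW d n) (nonempty_SAW hd n)

end SelfAvoidingWalk

/-!
For a given point `x`, consider the number of walks of length `n` that visit `x` at index `k`, as a
function of `k`. These numbers add up to at most the number of all walks, because a self-avoiding
walk visits `x` at most once. If the number at `k = n / 2` is not tiny, then, going in steps of two,
the numbers stay comparable to it over about `√n` indices, at least in one direction. This gives the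
bound.

The comparison comes from local moves. A *U-turn* is a piece `s, f, -s` of a walk, three sides
of a lattice square; it can always be replaced by the single step `f`, and conversely it can be
inserted in place of a step `f` if two points are free. Inserting a U-turn before the visit to `x`
and removing one after it keeps the length and moves the visiting index by two. Each move
raises the numbers of U-turns and of possible insertions, before and after the visit, by at most a
bounded amount (`numIns_short_le`, `numTurns_long_le`). Double counting of the moves in both
directions and the Cauchy–Schwarz inequality (`sq_card_goodPairs_le`) show that the logarithm of
the number of walks visiting `x` at index `k`, where this number is not tiny, has second
differences at least of order `-1 / n` (`exists_almost_logConvex`). Hence, in at least one of the two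
directions, this number stays of the same order over about `√n` steps
(`half_le_of_almost_logConvex`).

This needs that, up to an exponentially small proportion, walks have linearly many U-turns and
linearly many possible insertions in each half (`exists_card_badTriples_le`).

* U-turns: the number of U-turns is superadditive under concatenation, so
  `∑ t ^ (number of U-turns)` over walks of length `n` is submultiplicative in `n`, and it suffices
  that for a single length the walks without U-turns number strictly less than the corresponding
  power of the connective constant (`exists_card_noTurn_lt`). By the
  Hammersley–Welsh decomposition, which cuts walks into pieces and so creates no U-turn, the
  generating function of walks without U-turns is finite where that of bridges without U-turns is.
  Irreducible bridges have total weight at most one at the critical point, and some of them have a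
  U-turn, so there the bridges without U-turns have a finite generating function. Walks whose
  number is at least the power of the connective constant for every length would make it diverge.
* Insertions: a walk with many U-turns and few insertions can lose any of its many U-turns, and the
  result can be reached in only a few ways. Iterating a small linear number of times bounds the
  number of such walks (`card_fewIns_mul_pow_le`).

Walks are encoded as words of steps, so that translations disappear, and concatenation, reversal
and reflection are operations on lists.
-/

namespace SelfAvoidingWalk

variable {d : ℕ}

open scoped ENNReal

/-! ### Words of lattice steps -/

/-- A unit step of `ℤ^d`: a coordinate axis together with a sign. -/
abbrev Step (d : ℕ) := Fin d × ℤˣ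

/-- The unit vector of a step. -/
def vec (s : Step d) : Fin d → ℤ := Pi.single s.1 (s.2 : ℤ)

/-- The opposite step. -/
def opp (s : Step d) : Step d := (s.1, -s.2)

@[simp] theorem vec_opp (s : Step d) : vec (opp s) = -vec s := by
  simp [vec, opp, Pi.single_neg]

@[simp] theorem opp_opp (s : Step d) : opp (opp s) = s := by simp [opp]

theorem vec_injective : Function.Injective (vec (d := d)) := by
  rintro ⟨i, a⟩ ⟨j, b⟩ h
  have hij : i = j := by
    by_contra hne
    have := congrFun h i
    simp [vec, hne] at this
  subst hij
  have := congrFun h i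
  simpa [vec, Units.ext_iff] using this

/-- The displacement of a word of steps. -/
def disp (w : List (Step d)) : Fin d → ℤ := (w.map vec).sum

@[simp] theorem disp_nil : disp ([] : List (Step d)) = 0 := rfl
@[simp] theorem disp_cons (s : Step d) (w : List (Step d)) : disp (s :: w) = vec s + disp w := by
  simp [disp]
@[simp] theorem disp_append (u v : List (Step d)) : disp (u ++ v) = disp u + disp v := by
  simp [disp]

/-- The points visited by the word `w` started from `x`, except for its endpoint. Leaving the
endpoint out makes `path` compatible with concatenation. -/
def path (x : Fin d → ℤ) : List (Step d) → List (Fin d → ℤ)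
  | [] => []
  | s :: w => x :: path (x + vec s) w

/-- All the points visited by the word `w` started from `x`, in order. -/
def verts (x : Fin d → ℤ) (w : List (Step d)) : List (Fin d → ℤ) := path x w ++ [x + disp w]

@[simp] theorem path_nil (x : Fin d → ℤ) : path x [] = [] := rfl
@[simp] theorem path_cons (x : Fin d → ℤ) (s : Step d) (w : List (Step d)) :
    path x (s :: w) = x :: path (x + vec s) w := rfl

theorem path_append (x : Fin d → ℤ) (u v : List (Step d)) :
    path x (u ++ v) = path x u ++ path (x + disp u) v := by
  induction u generalizing x with
  | nil => simp
  | cons s u ih => simp [ih, add_assoc]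

@[simp] theorem verts_nil (x : Fin d → ℤ) : verts x [] = [x] := by simp [verts]
@[simp] theorem verts_cons (x : Fin d → ℤ) (s : Step d) (w : List (Step d)) :
    verts x (s :: w) = x :: verts (x + vec s) w := by simp [verts, add_assoc]

theorem verts_append (x : Fin d → ℤ) (u v : List (Step d)) :
    verts x (u ++ v) = path x u ++ verts (x + disp u) v := by
  simp [verts, path_append, add_assoc]

theorem verts_add (x y : Fin d → ℤ) (w : List (Step d)) :
    verts (x + y) w = (verts y w).map (x + ·) := by
  induction w generalizing y with
  | nil => simp
  | cons s w ih => simp [← ih, add_assoc]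

theorem mem_verts {x y : Fin d → ℤ} {w : List (Step d)} :
    y ∈ verts x w ↔ ∃ p, p <+: w ∧ y = x + disp p := by
  induction w generalizing x with
  | nil => simp
  | cons s w ih =>
    simp only [verts_cons, List.mem_cons, ih, List.prefix_cons_iff]
    constructor
    · rintro (h | ⟨p, hp, h⟩)
      · exact ⟨[], Or.inl rfl, by simpa using h⟩
      · exact ⟨s :: p, Or.inr ⟨p, rfl, hp⟩, by simpa [add_assoc] using h⟩
    · rintro ⟨p, rfl | ⟨t, rfl, ht⟩, h⟩
      · exact Or.inl (by simpa using h)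
      · exact Or.inr ⟨t, ht, by simpa [add_assoc] using h⟩

theorem mem_path {x y : Fin d → ℤ} {w : List (Step d)} :
    y ∈ path x w ↔ ∃ p s q, w = p ++ s :: q ∧ y = x + disp p := by
  induction w generalizing x with
  | nil => simp
  | cons s w ih =>
    simp only [path_cons, List.mem_cons, ih]
    constructor
    · rintro (h | ⟨p, t, q, rfl, h⟩)
      · exact ⟨[], s, w, rfl, by simpa using h⟩
      · exact ⟨s :: p, t, q, rfl, by simpa [add_assoc] using h⟩
    · rintro ⟨p, t, q, h1, h2⟩
      cases p with
      | nil => exact Or.inl (by simpa using h2)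
      | cons a p =>
        simp only [List.cons_append, List.cons.injEq] at h1
        obtain ⟨rfl, rfl⟩ := h1
        exact Or.inr ⟨p, t, q, rfl, by simpa [add_assoc] using h2⟩

theorem self_mem_verts (x : Fin d → ℤ) (w : List (Step d)) : x ∈ verts x w :=
  mem_verts.2 ⟨[], List.nil_prefix, by simp⟩

/-- A word is self-avoiding if it visits distinct points. -/
def IsSAW (w : List (Step d)) : Prop := (verts 0 w).Nodup

instance : DecidablePred (IsSAW (d := d)) := fun w =>
  inferInstanceAs (Decidable (verts 0 w).Nodup)

theorem nodup_verts_iff (x : Fin d → ℤ) (w : List (Step d)) : (verts x w).Nodup ↔ IsSAW w := by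
  have h := verts_add x 0 w
  rw [add_zero] at h
  rw [h, List.nodup_map_iff (add_right_injective x), IsSAW]

theorem isSAW_nil : IsSAW ([] : List (Step d)) := by simp [IsSAW]

theorem isSAW_append_iff {u v : List (Step d)} :
    IsSAW (u ++ v) ↔ (path 0 u).Nodup ∧ IsSAW v ∧ ∀ y ∈ path 0 u, y ∉ verts (disp u) v := by
  rw [IsSAW, verts_append, List.nodup_append', zero_add, nodup_verts_iff, List.disjoint_left]

theorem IsSAW.right {u v : List (Step d)} (h : IsSAW (u ++ v)) : IsSAW v :=
  (isSAW_append_iff.1 h).2.1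

theorem IsSAW.left {u v : List (Step d)} (h : IsSAW (u ++ v)) : IsSAW u := by
  rw [isSAW_append_iff] at h
  rw [IsSAW, verts, List.nodup_append', zero_add]
  refine ⟨h.1, by simp, ?_⟩
  rw [List.disjoint_left]
  intro y hy hy2
  rw [List.mem_singleton] at hy2
  subst hy2
  exact h.2.2 _ hy (self_mem_verts _ _)

theorem isSAW_append_of {u v : List (Step d)} (hu : IsSAW u) (hv : IsSAW v)
    (h : ∀ y ∈ path 0 u, y ∉ verts (disp u) v) : IsSAW (u ++ v) := by
  refine isSAW_append_iff.2 ⟨?_, hv, h⟩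
  rw [IsSAW, verts, List.nodup_append'] at hu
  exact hu.1

/-- A nonempty piece of a self-avoiding word does not return to its starting point. -/
theorem IsSAW.disp_ne_zero {w : List (Step d)} (h : IsSAW w) (hw : w ≠ []) : disp w ≠ 0 := by
  cases w with
  | nil => exact absurd rfl hw
  | cons s w =>
    rw [IsSAW, verts_cons, List.nodup_cons] at h
    intro h0
    apply h.1
    rw [mem_verts]
    exact ⟨w, List.prefix_rfl, by simpa using h0.symm⟩

theorem IsSAW.eq_of_disp_eq {p q p' q' : List (Step d)} (h : IsSAW (p ++ q))
    (he : p ++ q = p' ++ q') (hd : disp p = disp p') : p = p' ∧ q = q' := by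
  rcases List.append_eq_append_iff.1 he with ⟨t, h1, h2⟩ | ⟨t, h1, h2⟩
  · subst h1 h2
    rcases eq_or_ne t [] with rfl | ht
    · simp
    · exact absurd (by simpa using hd) ((h.right).left.disp_ne_zero ht)
  · subst h1 h2
    rcases eq_or_ne t [] with rfl | ht
    · simp
    · rw [List.append_assoc] at h
      exact absurd (by simpa using hd) ((h.right).left.disp_ne_zero ht)

/-! ### Reversal and reflection -/

/-- The word that traverses `w` backwards. -/
def rev (w : List (Step d)) : List (Step d) := (w.map opp).reverse

@[simp] theorem rev_nil : rev ([] : List (Step d)) = [] := rfl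
@[simp] theorem rev_append (u v : List (Step d)) : rev (u ++ v) = rev v ++ rev u := by simp [rev]
@[simp] theorem rev_cons (s : Step d) (w : List (Step d)) : rev (s :: w) = rev w ++ [opp s] := by
  simp [rev]
@[simp] theorem length_rev (w : List (Step d)) : (rev w).length = w.length := by simp [rev]
@[simp] theorem rev_rev (w : List (Step d)) : rev (rev w) = w := by
  induction w with
  | nil => rfl
  | cons s w ih => simp [ih]
@[simp] theorem disp_rev (w : List (Step d)) : disp (rev w) = -disp w := by
  induction w with
  | nil => simp
  | cons s w ih => simp [ih]

theorem verts_rev (x : Fin d → ℤ) (w : List (Step d)) :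
    verts (x + disp w) (rev w) = (verts x w).reverse := by
  induction w generalizing x with
  | nil => simp
  | cons s w ih =>
    have h := ih (x + vec s)
    rw [verts_cons, List.reverse_cons, ← h, disp_cons, ← add_assoc, rev_cons, verts_append]
    simp [verts, add_assoc]

theorem IsSAW.rev {w : List (Step d)} (h : IsSAW w) : IsSAW (rev w) := by
  rw [← nodup_verts_iff (0 + disp w), verts_rev, List.nodup_reverse]
  exact h

/-- The reflection of a step in the hyperplane orthogonal to the axis `o`. -/
def reflStep (o : Fin d) (s : Step d) : Step d := if s.1 = o then opp s else s

/-- The reflection of a word in the hyperplane orthogonal to the axis `o`. -/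
def refl (o : Fin d) (w : List (Step d)) : List (Step d) := w.map (reflStep o)

/-- The reflection of a point in the hyperplane orthogonal to the axis `o`. -/
def reflPt (o : Fin d) (x : Fin d → ℤ) : Fin d → ℤ := Function.update x o (-x o)

theorem reflStep_opp (o : Fin d) (s : Step d) : reflStep o (opp s) = opp (reflStep o s) := by
  unfold reflStep opp; split_ifs <;> simp_all

@[simp] theorem reflStep_reflStep (o : Fin d) (s : Step d) : reflStep o (reflStep o s) = s := by
  obtain ⟨a, e⟩ := s
  unfold reflStep opp
  rcases eq_or_ne a o with h | h <;> simp [h]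

@[simp] theorem refl_refl (o : Fin d) (w : List (Step d)) : refl o (refl o w) = w := by
  simp [refl, Function.comp_def]

@[simp] theorem refl_nil (o : Fin d) : refl o [] = [] := rfl
@[simp] theorem refl_append (o : Fin d) (u v : List (Step d)) :
    refl o (u ++ v) = refl o u ++ refl o v := by simp [refl]
@[simp] theorem length_refl (o : Fin d) (w : List (Step d)) : (refl o w).length = w.length := by
  simp [refl]

theorem reflPt_add (o : Fin d) (x y : Fin d → ℤ) : reflPt o (x + y) = reflPt o x + reflPt o y := by
  funext i
  rcases eq_or_ne i o with rfl | h
  · simp [reflPt]; ring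
  · simp [reflPt, h]

theorem reflPt_injective (o : Fin d) : Function.Injective (reflPt o) := by
  intro x y h
  funext i
  have := congrFun h i
  rcases eq_or_ne i o with rfl | hi
  · simpa [reflPt] using this
  · simpa [reflPt, hi] using this

theorem vec_reflStep (o : Fin d) (s : Step d) : vec (reflStep o s) = reflPt o (vec s) := by
  funext i
  obtain ⟨a, e⟩ := s
  unfold reflStep
  rcases eq_or_ne a o with rfl | h
  · rcases eq_or_ne i a with rfl | hi
    · simp [reflPt, vec, opp]
    · simp [reflPt, vec, opp, hi]
  · rcases eq_or_ne i o with rfl | hi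
    · simp [reflPt, vec, h]
    · simp [reflPt, vec, h, hi]

theorem verts_refl (o : Fin d) (x : Fin d → ℤ) (w : List (Step d)) :
    verts (reflPt o x) (refl o w) = (verts x w).map (reflPt o) := by
  induction w generalizing x with
  | nil => simp
  | cons s w ih =>
    have : refl o (s :: w) = reflStep o s :: refl o w := rfl
    rw [this, verts_cons, verts_cons, List.map_cons, ← ih, reflPt_add, vec_reflStep]

theorem IsSAW.refl {w : List (Step d)} (h : IsSAW w) (o : Fin d) : IsSAW (refl o w) := by
  rw [← nodup_verts_iff (reflPt o 0), verts_refl, List.nodup_map_iff (reflPt_injective o)]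
  exact h

/-! ### Heights, half-space words and bridges -/

/-- The height of the endpoint of a word in the direction of the axis `o`. -/
def ht (o : Fin d) (w : List (Step d)) : ℤ := disp w o

@[simp] theorem ht_nil (o : Fin d) : ht o [] = 0 := rfl
@[simp] theorem ht_append (o : Fin d) (u v : List (Step d)) : ht o (u ++ v) = ht o u + ht o v := by
  simp [ht]
@[simp] theorem ht_cons (o : Fin d) (s : Step d) (w : List (Step d)) :
    ht o (s :: w) = vec s o + ht o w := by simp [ht]
@[simp] theorem ht_rev (o : Fin d) (w : List (Step d)) : ht o (rev w) = -ht o w := by simp [ht]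
@[simp] theorem ht_refl (o : Fin d) (w : List (Step d)) : ht o (refl o w) = -ht o w := by
  induction w with
  | nil => simp
  | cons s w ih =>
    have : refl o (s :: w) = reflStep o s :: refl o w := rfl
    rw [this, ht_cons, ht_cons, ih, vec_reflStep]
    simp [reflPt]; ring

theorem vec_apply_le_one (s : Step d) (o : Fin d) : vec s o ≤ 1 := by
  obtain ⟨a, e⟩ := s
  rcases Int.units_eq_one_or e with rfl | rfl <;>
  rcases eq_or_ne o a with rfl | h <;> simp [vec, *]

/-- A word is a half-space word if it stays strictly above its starting point. -/
def IsHalf (o : Fin d) (w : List (Step d)) : Prop := ∀ p, p <+: w → p ≠ [] → 0 < ht o p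

/-- A word is a bridge if it stays strictly above its starting point and nowhere exceeds the
height of its endpoint. -/
def IsBridge (o : Fin d) (w : List (Step d)) : Prop :=
  IsHalf o w ∧ ∀ p, p <+: w → ht o p ≤ ht o w

theorem IsHalf.left {o : Fin d} {u v : List (Step d)} (h : IsHalf o (u ++ v)) : IsHalf o u :=
  fun p hp => h p (hp.trans (List.prefix_append u v))

theorem isBridge_nil (o : Fin d) : IsBridge o [] := by
  refine ⟨fun p hp h => absurd (List.prefix_nil.1 hp) h, fun p hp => ?_⟩
  rw [List.prefix_nil.1 hp]

theorem prefix_append_cases {α : Type*} {p u v : List α} (h : p <+: u ++ v) :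
    p <+: u ∨ ∃ t, t ≠ [] ∧ t <+: v ∧ p = u ++ t := by
  obtain ⟨q, hq⟩ := h
  rcases List.append_eq_append_iff.1 hq with ⟨t, h1, h2⟩ | ⟨t, h1, h2⟩
  · exact Or.inl ⟨t, h1.symm⟩
  · rcases eq_or_ne t [] with rfl | ht
    · exact Or.inl ⟨[], by simpa using h1⟩
    · exact Or.inr ⟨t, ht, ⟨q, h2.symm⟩, h1⟩

theorem IsBridge.append {o : Fin d} {u v : List (Step d)} (hu : IsBridge o u) (hv : IsBridge o v) :
    IsBridge o (u ++ v) := by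
  have hu0 : 0 ≤ ht o u := by simpa using hu.2 [] List.nil_prefix
  have hv0 : 0 ≤ ht o v := by simpa using hv.2 [] List.nil_prefix
  constructor
  · intro p hp hne
    rcases prefix_append_cases hp with h | ⟨t, h1, h2, rfl⟩
    · exact hu.1 p h hne
    · have := hv.1 t h2 h1
      simp; omega
  · intro p hp
    rcases prefix_append_cases hp with h | ⟨t, h1, h2, rfl⟩
    · have := hu.2 p h
      simp; omega
    · have := hv.2 t h2
      simp; omega

/-- Concatenating bridges preserves self-avoidance, as the two pieces are separated by a
hyperplane. -/
theorem IsBridge.isSAW_append {o : Fin d} {u v : List (Step d)} (hu : IsBridge o u)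
    (hv : IsHalf o v) (su : IsSAW u) (sv : IsSAW v) : IsSAW (u ++ v) := by
  refine isSAW_append_of su sv ?_
  intro y hy hy2
  obtain ⟨p, s, q, rfl, rfl⟩ := mem_path.1 hy
  obtain ⟨t, ht1, ht2⟩ := mem_verts.1 hy2
  rw [zero_add] at ht2
  rcases eq_or_ne t [] with rfl | hne
  · rw [disp_nil, add_zero, disp_append] at ht2
    exact su.right.disp_ne_zero (by simp) (by simpa using ht2)
  · have h1 := hv t ht1 hne
    have h2 := hu.2 p (List.prefix_append _ _)
    have h3 := congrFun ht2 o
    simp only [Pi.add_apply] at h3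
    change ht o p = ht o _ + ht o t at h3
    omega

/-- A word splits at the last visit to its maximal height. -/
theorem exists_last_max (o : Fin d) (w : List (Step d)) :
    ∃ u v, w = u ++ v ∧ (∀ p, p <+: w → ht o p ≤ ht o u) ∧
      ∀ p, p <+: v → p ≠ [] → ht o p < 0 := by
  induction w with
  | nil => exact ⟨[], [], by simp, by simp, by simp⟩
  | cons s w ih =>
    obtain ⟨u, v, hw, h1, h2⟩ := ih
    by_cases hs : 0 ≤ vec s o + ht o u
    · refine ⟨s :: u, v, by simp [hw], ?_, h2⟩
      intro p hp
      rcases List.prefix_cons_iff.1 hp with rfl | ⟨t, rfl, ht'⟩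
      · simpa using hs
      · simpa using h1 t ht'
    · refine ⟨[], s :: w, by simp, ?_, ?_⟩
      · intro p hp
        rcases List.prefix_cons_iff.1 hp with rfl | ⟨t, rfl, ht'⟩
        · simp
        · have := h1 t ht'
          simp; omega
      · intro p hp hne
        rcases List.prefix_cons_iff.1 hp with rfl | ⟨t, rfl, ht'⟩
        · simp at hne
        · have := h1 t ht'
          simp; omega

/-! ### Counting self-avoiding words and the connective constant -/

/-- The finite set of self-avoiding words of length `n`. -/
noncomputable def saws (d n : ℕ) : Finset (List (Step d)) :=
  {w ∈ (List.finite_length_eq (Step d) n).toFinset | IsSAW w}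

@[simp] theorem mem_saws {n : ℕ} {w : List (Step d)} : w ∈ saws d n ↔ w.length = n ∧ IsSAW w := by
  simp [saws]

theorem isSAW_replicate (o : Fin d) (n : ℕ) : IsSAW (List.replicate n ((o, 1) : Step d)) := by
  induction n with
  | zero => exact isSAW_nil
  | succ n ih =>
    rw [List.replicate_succ, ← List.singleton_append]
    refine IsBridge.isSAW_append (o := o) ⟨?_, ?_⟩ ?_ ?_ ih
    · intro p hp hne
      rcases List.prefix_cons_iff.1 hp with rfl | ⟨t, rfl, ht'⟩
      · exact absurd rfl hne
      · rw [List.prefix_nil.1 ht']; simp [vec]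
    · intro p hp
      rcases List.prefix_cons_iff.1 hp with rfl | ⟨t, rfl, ht'⟩
      · simp [vec]
      · rw [List.prefix_nil.1 ht']
    · intro p hp hne
      have : ht o p = p.length := by
        have h1 : p = List.replicate p.length (o, 1) :=
          List.eq_replicate_iff.2 ⟨rfl, fun b hb => (List.eq_of_mem_replicate (hp.subset hb))⟩
        rw [h1]
        generalize p.length = k
        induction k with
        | zero => simp
        | succ k ih => rw [List.replicate_succ, ht_cons, ih]; simp [vec]; ring
      rw [this]
      have := List.length_pos_iff.2 hne
      exact_mod_cast this
    · simp only [IsSAW, verts_cons, verts_nil, List.nodup_cons, List.mem_singleton, zero_add]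
      refine ⟨fun h => ?_, by simp⟩
      simpa [vec] using congrFun h o

theorem saws_card_pos (o : Fin d) (n : ℕ) : 0 < (saws d n).card :=
  Finset.card_pos.2 ⟨List.replicate n (o, 1), by simp [isSAW_replicate]⟩

theorem sum_saws_add_le (f : List (Step d) → ℝ) (hf : ∀ w, 0 ≤ f w)
    (hmul : ∀ u v, f (u ++ v) ≤ f u * f v) (m n : ℕ) :
    ∑ w ∈ saws d (m + n), f w ≤ (∑ w ∈ saws d m, f w) * ∑ w ∈ saws d n, f w := by
  rw [Finset.sum_mul_sum, ← Finset.sum_product']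
  calc ∑ w ∈ saws d (m + n), f w
      ≤ ∑ w ∈ saws d (m + n), f (w.take m) * f (w.drop m) := by
        refine Finset.sum_le_sum fun w _ => ?_
        conv_lhs => rw [← List.take_append_drop m w]
        exact hmul _ _
    _ = ∑ x ∈ (saws d (m + n)).image (fun w => (w.take m, w.drop m)), f x.1 * f x.2 := by
        rw [Finset.sum_image]
        intro a _ b _ h
        rw [Prod.mk.injEq] at h
        rw [← List.take_append_drop m a, h.1, h.2, List.take_append_drop]
    _ ≤ _ := by
        refine Finset.sum_le_sum_of_subset_of_nonneg ?_ fun x _ _ => mul_nonneg (hf _) (hf _)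
        intro x hx
        obtain ⟨w, hw, rfl⟩ := Finset.mem_image.1 hx
        rw [mem_saws] at hw
        have h := hw.2
        rw [← List.take_append_drop m w] at h
        simp only [Finset.mem_product, mem_saws]
        refine ⟨⟨?_, h.left⟩, ?_, h.right⟩ <;> simp [hw.1]

theorem saws_card_add_le (m n : ℕ) :
    ((saws d (m + n)).card : ℝ) ≤ (saws d m).card * (saws d n).card := by
  simpa using sum_saws_add_le (d := d) (fun _ => 1) (fun _ => zero_le_one) (by simp) m n

/-- The connective constant of `ℤ^d`. By submultiplicativity the infimum is also the limit of
the `n`-th roots of the numbers of self-avoiding words. -/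
noncomputable def connectiveConstant (d : ℕ) : ℝ :=
  ⨅ n : ℕ, ((saws d (n + 1)).card : ℝ) ^ (((n + 1 : ℕ) : ℝ)⁻¹)

theorem bddBelow_connectiveConstant :
    BddBelow (Set.range fun n : ℕ => ((saws d (n + 1)).card : ℝ) ^ (((n + 1 : ℕ) : ℝ)⁻¹)) :=
  ⟨0, by rintro _ ⟨n, rfl⟩; positivity⟩

theorem one_le_connectiveConstant (o : Fin d) : 1 ≤ connectiveConstant d :=
  le_ciInf fun n => Real.one_le_rpow (by exact_mod_cast saws_card_pos o _) (by positivity)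

theorem connectiveConstant_pow_le (o : Fin d) (n : ℕ) :
    connectiveConstant d ^ n ≤ (saws d n).card := by
  cases n with
  | zero => simpa using saws_card_pos o 0
  | succ n =>
    have h : connectiveConstant d ≤ _ := ciInf_le bddBelow_connectiveConstant n
    calc connectiveConstant d ^ (n + 1) ≤ _ :=
          pow_le_pow_left₀ (zero_le_one.trans (one_le_connectiveConstant o)) h _
      _ = _ := Real.rpow_inv_natCast_pow (by positivity) (by simp)

theorem exists_card_le_pow {b : ℝ} (hb : connectiveConstant d < b) :
    ∃ m, 1 ≤ m ∧ ((saws d m).card : ℝ) ≤ b ^ m := by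
  obtain ⟨n, hn⟩ := exists_lt_of_ciInf_lt hb
  refine ⟨n + 1, by omega, ?_⟩
  calc ((saws d (n + 1)).card : ℝ) = _ := (Real.rpow_inv_natCast_pow (by positivity)
        (Nat.succ_ne_zero n)).symm
    _ ≤ b ^ (n + 1) := pow_le_pow_left₀ (by positivity) hn.le _

/-- A submultiplicative sequence that once drops below a geometric sequence is bounded by a
multiple of that sequence. -/
theorem exists_le_mul_pow_of_submul {f : ℕ → ℝ} (hf : ∀ n, 0 ≤ f n)
    (hmul : ∀ m n, f (m + n) ≤ f m * f n) {b : ℝ} (hb : 0 < b) {m : ℕ} (hm : 1 ≤ m)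
    (h : f m ≤ b ^ m) : ∃ K, 0 < K ∧ ∀ n, f n ≤ K * b ^ n := by
  refine ⟨1 + ∑ r ∈ Finset.range m, f r / b ^ r, by
    have : 0 ≤ ∑ r ∈ Finset.range m, f r / b ^ r :=
      Finset.sum_nonneg fun r _ => div_nonneg (hf r) (by positivity)
    linarith, fun n => ?_⟩
  induction n using Nat.strong_induction_on with
  | _ n ih =>
    rcases lt_or_ge n m with hn | hn
    · have h1 : f n / b ^ n ≤ ∑ r ∈ Finset.range m, f r / b ^ r :=
        Finset.single_le_sum (f := fun r => f r / b ^ r)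
          (fun r _ => div_nonneg (hf r) (by positivity)) (Finset.mem_range.2 hn)
      rw [← div_le_iff₀ (by positivity)]
      linarith
    · obtain ⟨k, rfl⟩ := Nat.exists_eq_add_of_le hn
      have h1 := ih k (by omega)
      calc f (m + k) ≤ f m * f k := hmul m k
        _ ≤ b ^ m * ((1 + ∑ r ∈ Finset.range m, f r / b ^ r) * b ^ k) :=
          mul_le_mul h h1 (hf k) (by positivity)
        _ = _ := by ring

theorem exists_card_le_mul_pow {b : ℝ} (o : Fin d) (hb : connectiveConstant d < b) :
    ∃ K, 0 < K ∧ ∀ n, ((saws d n).card : ℝ) ≤ K * b ^ n := by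
  obtain ⟨m, hm, h⟩ := exists_card_le_pow hb
  exact exists_le_mul_pow_of_submul (f := fun n => ((saws d n).card : ℝ)) (fun n => by positivity)
    saws_card_add_le (by linarith [one_le_connectiveConstant o]) hm h

/-! ### Generating functions -/

/-- The generating function, by length, of a set of words. -/
noncomputable def gf (z : ℝ≥0∞) (A : Set (List (Step d))) : ℝ≥0∞ := ∑' w : A, z ^ w.1.length

theorem gf_mono (z : ℝ≥0∞) {A B : Set (List (Step d))} (h : A ⊆ B) : gf z A ≤ gf z B :=
  ENNReal.tsum_mono_subtype (fun w : List (Step d) => z ^ w.length) h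

theorem gf_union_le (z : ℝ≥0∞) (A B : Set (List (Step d))) : gf z (A ∪ B) ≤ gf z A + gf z B :=
  ENNReal.tsum_union_le (fun w : List (Step d) => z ^ w.length) A B

theorem gf_mul_gf (z : ℝ≥0∞) (A B : Set (List (Step d))) :
    gf z A * gf z B = ∑' x : A × B, z ^ (x.1.1.length + x.2.1.length) := by
  rw [ENNReal.tsum_prod (f := fun (a : A) (b : B) => z ^ (a.1.length + b.1.length)), gf,
    ← ENNReal.tsum_mul_right]
  refine tsum_congr fun a => ?_
  rw [gf, ← ENNReal.tsum_mul_left]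
  exact tsum_congr fun b => (pow_add _ _ _).symm

theorem gf_le_mul {z : ℝ≥0∞} {A B C : Set (List (Step d))} (e : ℕ)
    (f : List (Step d) → List (Step d) × List (Step d)) (hf : Set.InjOn f A)
    (hB : ∀ w ∈ A, (f w).1 ∈ B) (hC : ∀ w ∈ A, (f w).2 ∈ C)
    (hl : ∀ w ∈ A, (f w).1.length + (f w).2.length = e + w.length) :
    z ^ e * gf z A ≤ gf z B * gf z C := by
  rw [gf_mul_gf, gf, ← ENNReal.tsum_mul_left]
  let g : A → B × C := fun w => (⟨(f w).1, hB w w.2⟩, ⟨(f w).2, hC w w.2⟩)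
  have hg : Function.Injective g := by
    intro a b h
    simp only [g, Prod.mk.injEq, Subtype.mk.injEq] at h
    exact Subtype.ext (hf a.2 b.2 (Prod.ext h.1 h.2))
  refine le_trans (le_of_eq ?_) (ENNReal.tsum_comp_le_tsum_of_injective hg _)
  refine tsum_congr fun w => ?_
  rw [← pow_add, ← hl w w.2]

open Classical in
theorem gf_eq_tsum (z : ℝ≥0∞) (A : Set (List (Step d))) (hA : ∀ w ∈ A, IsSAW w) :
    gf z A = ∑' n, (({w ∈ saws d n | w ∈ A}).card : ℝ≥0∞) * z ^ n := by
  rw [gf, ← (Equiv.sigmaFiberEquiv (fun w : A => w.1.length)).tsum_eq, ENNReal.tsum_sigma']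
  refine tsum_congr fun n => ?_
  have : ∀ w : {w : A // w.1.length = n}, z ^ ((Equiv.sigmaFiberEquiv
      (fun w : A => w.1.length)) ⟨n, w⟩).1.length = z ^ n := by
    intro w
    rw [Equiv.sigmaFiberEquiv_apply, w.2]
  rw [tsum_congr this, ENNReal.tsum_const]
  congr 1
  let e : {w : A // w.1.length = n} ≃ ({w ∈ saws d n | w ∈ A} : Finset (List (Step d))) :=
    { toFun := fun w => ⟨w.1.1, by simp [w.2, hA _ w.1.2]⟩
      invFun := fun w => ⟨⟨w.1, (Finset.mem_filter.1 w.2).2⟩,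
        (mem_saws.1 (Finset.mem_filter.1 w.2).1).1⟩
      left_inv := fun w => rfl
      right_inv := fun w => rfl }
  rw [ENat.card_congr e, ENat.card_eq_coe_fintype_card, Fintype.card_coe]
  simp

/-! ### Words without U-turns -/

/-- A word has no U-turn if it never makes a step, another step, and then the opposite of the
first one. In a self-avoiding word the middle step is then perpendicular to the outer two, so that
a U-turn runs along three sides of a lattice square. -/
def NoTurn (w : List (Step d)) : Prop := ∀ p s f q, w ≠ p ++ s :: f :: opp s :: q

theorem NoTurn.left {u v : List (Step d)} (h : NoTurn (u ++ v)) : NoTurn u := by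
  rintro p s f q rfl
  exact h p s f (q ++ v) (by simp)

theorem NoTurn.right {u v : List (Step d)} (h : NoTurn (u ++ v)) : NoTurn v := by
  rintro p s f q rfl
  exact h (u ++ p) s f q (by simp)

theorem NoTurn.refl {w : List (Step d)} (h : NoTurn w) (o : Fin d) : NoTurn (refl o w) := by
  intro p s f q hw
  apply h (SelfAvoidingWalk.refl o p) (reflStep o s) (reflStep o f) (SelfAvoidingWalk.refl o q)
  rw [← refl_refl o w, hw]
  simp [SelfAvoidingWalk.refl, reflStep_opp]

theorem NoTurn.rev {w : List (Step d)} (h : NoTurn w) : NoTurn (rev w) := by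
  intro p s f q hw
  apply h (SelfAvoidingWalk.rev q) s (opp f) (SelfAvoidingWalk.rev p)
  rw [← rev_rev w, hw]
  simp

/-- Self-avoiding words without U-turns. -/
def noTurnWords (d : ℕ) : Set (List (Step d)) := {w | IsSAW w ∧ NoTurn w}

/-- Self-avoiding half-space words without U-turns. -/
def noTurnHalf (o : Fin d) : Set (List (Step d)) := {w | IsSAW w ∧ NoTurn w ∧ IsHalf o w}

/-- Self-avoiding half-space words without U-turns, of height at most `L`. -/
def noTurnHalfLE (o : Fin d) (L : ℕ) : Set (List (Step d)) :=
  {w | w ∈ noTurnHalf o ∧ ∀ p, p <+: w → ht o p ≤ L}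

/-- Self-avoiding bridges without U-turns. -/
def noTurnBridges (o : Fin d) : Set (List (Step d)) := {w | IsSAW w ∧ NoTurn w ∧ IsBridge o w}

/-! ### The Hammersley–Welsh decomposition -/

/-- A half-space word of height `L + 1` is a bridge of that height followed by the reflection of a
half-space word of smaller height. -/
theorem gf_noTurnHalfLE_succ_le (z : ℝ≥0∞) (o : Fin d) (L : ℕ) :
    gf z (noTurnHalfLE o (L + 1)) ≤
      gf z (noTurnHalfLE o L) *
        (1 + gf z {w | w ∈ noTurnBridges o ∧ ht o w = (L + 1 : ℕ)}) := by
  classical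
  have hsub : noTurnHalfLE o (L + 1) ⊆ noTurnHalfLE o L ∪
      {w | w ∈ noTurnHalfLE o (L + 1) ∧ ∃ p, p <+: w ∧ ht o p = (L + 1 : ℕ)} := by
    intro w hw
    by_cases h : ∃ p, p <+: w ∧ ht o p = (L + 1 : ℕ)
    · exact Or.inr ⟨hw, h⟩
    · refine Or.inl ⟨hw.1, fun p hp => ?_⟩
      have h1 := hw.2 p hp
      have h2 : ht o p ≠ (L + 1 : ℕ) := fun h3 => h ⟨p, hp, h3⟩
      push_cast at h1 h2
      omega
  choose u v huv hmax hlt using exists_last_max o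
  have key : z ^ 0 * gf z
        {w | w ∈ noTurnHalfLE o (L + 1) ∧ ∃ p, p <+: w ∧ ht o p = (L + 1 : ℕ)} ≤
      gf z {w | w ∈ noTurnBridges o ∧ ht o w = (L + 1 : ℕ)} * gf z (noTurnHalfLE o L) := by
    have hht : ∀ w ∈ {w | w ∈ noTurnHalfLE o (L + 1) ∧ ∃ p, p <+: w ∧ ht o p = (L + 1 : ℕ)},
        ht o (u w) = (L + 1 : ℕ) := by
      rintro w ⟨hw, p, hp, hpL⟩
      refine le_antisymm (hw.2 _ ⟨v w, (huv w).symm⟩) ?_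
      rw [← hpL]
      exact hmax w p hp
    refine gf_le_mul 0 (fun w => (u w, refl o (v w))) ?_ ?_ ?_ ?_
    · intro a _ b _ h
      simp only [Prod.mk.injEq] at h
      rw [huv a, huv b, h.1, ← refl_refl o (v a), h.2, refl_refl]
    · intro w hw
      have hw1 := hw.1.1
      have hL := hht w hw
      rw [noTurnHalf, Set.mem_ofPred_eq, huv w] at hw1
      refine ⟨⟨hw1.1.left, hw1.2.1.left, hw1.2.2.left, fun p hp => ?_⟩, hL⟩
      refine hmax w p (hp.trans ⟨v w, (huv w).symm⟩)
    · intro w hw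
      have hw1 := hw.1.1
      have hL := hht w hw
      rw [noTurnHalf, Set.mem_ofPred_eq, huv w] at hw1
      refine ⟨⟨hw1.1.right.refl o, hw1.2.1.right.refl o, ?_⟩, ?_⟩
      · rintro p ⟨q, hq⟩ hne
        have h1 : refl o p <+: v w := ⟨refl o q, by rw [← refl_append, hq, refl_refl]⟩
        have h2 := hlt w _ h1 (by simpa [refl] using hne)
        rw [ht_refl] at h2
        omega
      · rintro p ⟨q, hq⟩
        have h1 : refl o p <+: v w := ⟨refl o q, by rw [← refl_append, hq, refl_refl]⟩
        have hu : u w ≠ [] := by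
          intro h
          rw [h, ht_nil] at hL
          push_cast at hL
          omega
        have h2 := hw1.2.2 (u w ++ refl o p) ((List.prefix_append_right_inj _).2 h1) (by simp [hu])
        rw [ht_append, ht_refl, hL] at h2
        push_cast at h2
        omega
    · intro w _
      conv_rhs => rw [huv w]
      simp
  rw [pow_zero, one_mul] at key
  calc gf z (noTurnHalfLE o (L + 1)) ≤ _ := gf_mono z hsub
    _ ≤ _ := gf_union_le _ _ _
    _ ≤ _ := add_le_add_right key _
    _ = _ := by ring

theorem gf_noTurnHalf_le (z : ℝ≥0∞) (o : Fin d) (h : gf z (noTurnBridges o) ≠ ∞) :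
    gf z (noTurnHalf o) ≤ ENNReal.ofReal (Real.exp (gf z (noTurnBridges o)).toReal) := by
  classical
  set b : ℕ → ℝ≥0∞ := fun l => gf z {w | w ∈ noTurnBridges o ∧ ht o w = (l + 1 : ℕ)} with hb
  have hbsum : ∀ L, ∑ l ∈ Finset.range L, b l ≤ gf z (noTurnBridges o) := by
    intro L
    calc ∑ l ∈ Finset.range L, b l ≤ ∑' l, b l := ENNReal.sum_le_tsum _
      _ = ∑' x : (Σ l : ℕ, {w | w ∈ noTurnBridges o ∧ ht o w = (l + 1 : ℕ)}),
            z ^ x.2.1.length := by rw [ENNReal.tsum_sigma']; rfl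
      _ ≤ _ := by
        let g : (Σ l : ℕ, ({w | w ∈ noTurnBridges o ∧ ht o w = (l + 1 : ℕ)} :
          Set (List (Step d)))) → noTurnBridges o := fun x => ⟨x.2.1, x.2.2.1⟩
        refine ENNReal.tsum_comp_le_tsum_of_injective (f := g) ?_
          (fun w : noTurnBridges o => z ^ w.1.length)
        rintro ⟨l, w, hw, hl⟩ ⟨l', w', hw', hl'⟩ he
        simp only [g, Subtype.mk.injEq] at he
        subst he
        have : l = l' := by rw [hl] at hl'; simpa using hl'
        subst this
        rfl
  have hbfin : ∀ l, b l ≠ ∞ := fun l => ne_top_of_le_ne_top h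
    ((Finset.single_le_sum (f := b) (fun _ _ => zero_le) (Finset.self_mem_range_succ l)).trans
      (hbsum (l + 1)))
  have hL : ∀ L : ℕ, gf z (noTurnHalfLE o L) ≤
      ENNReal.ofReal (Real.exp (∑ l ∈ Finset.range L, (b l).toReal)) := by
    intro L
    induction L with
    | zero =>
      have h0 : noTurnHalfLE o 0 ⊆ {[]} := by
        intro w hw
        by_contra hne
        have h1 := hw.1.2.2 w List.prefix_rfl hne
        have h2 := hw.2 w List.prefix_rfl
        push_cast at h2
        omega
      refine (gf_mono z h0).trans ?_
      simp [gf]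
    | succ L ih =>
      refine (gf_noTurnHalfLE_succ_le z o L).trans ?_
      rw [Finset.sum_range_succ, Real.exp_add, ENNReal.ofReal_mul (Real.exp_pos _).le]
      refine mul_le_mul' ih ?_
      change 1 + b L ≤ _
      rw [← ENNReal.ofReal_toReal (hbfin L), ← ENNReal.ofReal_one,
        ← ENNReal.ofReal_add zero_le_one ENNReal.toReal_nonneg, ENNReal.toReal_ofReal
          ENNReal.toReal_nonneg]
      refine ENNReal.ofReal_le_ofReal ?_
      rw [add_comm]
      exact Real.add_one_le_exp _
  have hL2 : ∀ L : ℕ, gf z (noTurnHalfLE o L) ≤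
      ENNReal.ofReal (Real.exp (gf z (noTurnBridges o)).toReal) := by
    intro L
    refine (hL L).trans (ENNReal.ofReal_le_ofReal (Real.exp_le_exp.2 ?_))
    rw [← ENNReal.toReal_sum fun l _ => hbfin l]
    exact ENNReal.toReal_mono h (hbsum L)
  rw [gf, ENNReal.tsum_eq_iSup_sum]
  refine iSup_le fun s => ?_
  have hex : ∃ L : ℕ, ∀ w ∈ s, w.1 ∈ noTurnHalfLE o L := by
    refine ⟨s.sup fun w => w.1.length, fun w hw => ⟨w.2, fun p hp => ?_⟩⟩
    have h1 : ht o p ≤ p.length := by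
      clear hp
      induction p with
      | nil => simp
      | cons a p ih =>
        have := vec_apply_le_one a o
        simp; omega
    have h2 := hp.length_le
    have h3 := Finset.le_sup (f := fun w : noTurnHalf o => w.1.length) hw
    omega
  obtain ⟨L, hLs⟩ := hex
  refine le_trans ?_ (hL2 L)
  have : ∑ w ∈ s, z ^ w.1.length =
      ∑ w ∈ s.attach.image (fun w => (⟨w.1.1, hLs w.1 w.2⟩ : noTurnHalfLE o L)),
        z ^ w.1.length := by
    rw [Finset.sum_image, Finset.sum_attach s (fun w => z ^ w.1.length)]
    intro a _ b _ hab
    simp only [Subtype.mk.injEq] at hab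
    exact Subtype.ext (Subtype.ext hab)
  rw [this]
  exact ENNReal.sum_le_tsum _

/-- A word splits at its last lowest point into two half-space words, once one extra upward step
is put in front of the reversal of the first piece. -/
theorem mul_gf_noTurnWords_le (z : ℝ≥0∞) (o : Fin d) :
    z ^ 1 * gf z (noTurnWords d) ≤ gf z (noTurnHalf o) * gf z (noTurnHalf o) := by
  have hw : ∀ w : List (Step d), ∃ u v, w = u ++ v ∧ (∀ a b, u = a ++ b → ht o b ≤ 0) ∧
      ∀ p, p <+: v → p ≠ [] → 0 < ht o p := by
    intro w
    obtain ⟨u, v, h1, h2, h3⟩ := exists_last_max o (refl o w)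
    refine ⟨refl o u, refl o v, by rw [← refl_append, ← h1, refl_refl], ?_, ?_⟩
    · intro a b hab
      have h4 := h2 (refl o a) ⟨refl o b ++ v, by
        rw [← List.append_assoc, ← refl_append, ← hab, refl_refl, h1]⟩
      have h5 : ht o u = ht o (refl o a) + ht o (refl o b) := by
        rw [← ht_append, ← refl_append, ← hab, refl_refl]
      rw [ht_refl o b] at h5
      omega
    · rintro p ⟨q, hq⟩ hne
      have h4 := h3 (refl o p) ⟨refl o q, by rw [← refl_append, hq, refl_refl]⟩
        (by simpa [refl] using hne)
      rw [ht_refl] at h4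
      omega
  choose u v huv hu hv using hw
  refine gf_le_mul 1 (fun w => ((o, 1) :: rev (u w), v w)) ?_ ?_ ?_ ?_
  · intro a _ b _ h
    simp only [Prod.mk.injEq, List.cons.injEq, true_and] at h
    rw [huv a, huv b, h.2, ← rev_rev (u a), h.1, rev_rev]
  · intro w hw
    rw [noTurnWords, Set.mem_ofPred_eq, huv w] at hw
    have hvo : vec ((o, 1) : Step d) o = 1 := by simp [vec]
    have hpre : ∀ p, p <+: rev (u w) → 0 ≤ ht o p := by
      rintro p ⟨q, hq⟩
      have := hu w (rev q) (rev p) (by rw [← rev_append, hq, rev_rev])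
      rw [ht_rev] at this
      omega
    have hhalf : IsHalf o ((o, 1) :: rev (u w)) := by
      intro p hp hne
      rcases List.prefix_cons_iff.1 hp with rfl | ⟨t, rfl, ht'⟩
      · exact absurd rfl hne
      · have := hpre t ht'
        rw [ht_cons, hvo]
        omega
    have hsaw : IsSAW ((o, 1) :: rev (u w)) := by
      rw [IsSAW, verts_cons, List.nodup_cons, nodup_verts_iff]
      refine ⟨?_, hw.1.left.rev⟩
      intro hmem
      obtain ⟨p, hp, h0⟩ := mem_verts.1 hmem
      have h1 := congrFun h0 o
      simp only [zero_add, Pi.add_apply, Pi.zero_apply, hvo] at h1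
      have := hpre p hp
      change 0 = 1 + ht o p at h1
      omega
    refine ⟨hsaw, ?_, hhalf⟩
    intro p s f q hpq
    cases p with
    | nil =>
      -- a U-turn starting with the extra step would go below the lowest point
      simp only [List.nil_append, List.cons.injEq] at hpq
      obtain ⟨rfl, h2⟩ := hpq
      have h3 := hpre [f, opp (o, 1)] (by rw [h2]; exact ⟨q, rfl⟩)
      have h4 := vec_apply_le_one f o
      have h5 : ht o [f, opp (o, 1)] = vec f o - 1 := by simp [hvo]; ring
      rw [h5] at h3
      have h6 : f = (o, 1) := by
        obtain ⟨a, e⟩ := f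
        have h7 : vec (a, e) o = 1 := by omega
        rcases eq_or_ne a o with rfl | hne
        · simpa [vec] using h7
        · simp [vec, hne.symm] at h7
      subst h6
      rw [h2] at hsaw
      have h8 : IsSAW ([(o, 1), opp (o, 1)] ++ q) := by
        rw [show (o, 1) :: (o, 1) :: opp (o, 1) :: q =
          [(o, 1)] ++ ([(o, 1), opp (o, 1)] ++ q) by rfl] at hsaw
        exact hsaw.right
      exact h8.left.disp_ne_zero (by simp) (by simp)
    | cons a p =>
      simp only [List.cons_append, List.cons.injEq] at hpq
      exact hw.2.left.rev p s f q hpq.2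
  · intro w hw
    rw [noTurnWords, Set.mem_ofPred_eq, huv w] at hw
    exact ⟨hw.1.right, hw.2.right, hv w⟩
  · intro w _
    conv_rhs => rw [huv w]
    simp
    omega

/-! ### Irreducible bridges -/

/-- A bridge is irreducible if it is nonempty and not the concatenation of two nonempty
bridges. -/
def IsIrreducible (o : Fin d) (w : List (Step d)) : Prop :=
  IsBridge o w ∧ w ≠ [] ∧ ∀ u v, w = u ++ v → IsBridge o u → IsBridge o v → u = [] ∨ v = []

/-- Self-avoiding bridges. -/
def bridges (o : Fin d) : Set (List (Step d)) := {w | IsSAW w ∧ IsBridge o w}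

/-- Self-avoiding irreducible bridges. -/
def irreducibles (o : Fin d) : Set (List (Step d)) := {w | IsSAW w ∧ IsIrreducible o w}

/-- Self-avoiding irreducible bridges without U-turns. -/
def noTurnIrreducibles (o : Fin d) : Set (List (Step d)) :=
  {w | IsSAW w ∧ NoTurn w ∧ IsIrreducible o w}

theorem exists_irreducible_append {o : Fin d} {w : List (Step d)} (hw : IsBridge o w)
    (hne : w ≠ []) : ∃ u v, w = u ++ v ∧ IsIrreducible o u ∧ IsBridge o v := by
  induction hn : w.length using Nat.strong_induction_on generalizing w with
  | _ n ih =>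
    by_cases hirr : IsIrreducible o w
    · exact ⟨w, [], by simp, hirr, isBridge_nil o⟩
    · have : ∃ u v, w = u ++ v ∧ IsBridge o u ∧ IsBridge o v ∧ u ≠ [] ∧ v ≠ [] := by
        by_contra hcon
        refine hirr ⟨hw, hne, fun u v huv hu hv => ?_⟩
        by_contra h
        rw [not_or] at h
        exact hcon ⟨u, v, huv, hu, hv, h.1, h.2⟩
      obtain ⟨u, v, rfl, hu, hv, hu0, hv0⟩ := this
      have hlen : u.length < n := by
        rw [← hn, List.length_append]
        have := List.length_pos_iff.2 hv0
        omega
      obtain ⟨a, b, rfl, ha, hb⟩ := ih _ hlen hu hu0 rfl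
      exact ⟨a, b ++ v, by simp, ha, hb.append hv⟩

theorem gf_noTurnBridges_le (z : ℝ≥0∞) (o : Fin d) (hz : z ≠ ∞) :
    gf z (noTurnBridges o) ≤ (1 - gf z (noTurnIrreducibles o))⁻¹ := by
  classical
  set a := gf z (noTurnIrreducibles o) with ha
  -- truncation makes the generating function finite, so that the renewal inequality can be solved
  have htr : ∀ N : ℕ, gf z {w | w ∈ noTurnBridges o ∧ w.length ≤ N} ≤ (1 - a)⁻¹ := by
    intro N
    set x := gf z {w | w ∈ noTurnBridges o ∧ w.length ≤ N} with hx
    have hxfin : x ≠ ∞ := by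
      have hfin : ({w | w ∈ noTurnBridges o ∧ w.length ≤ N} : Set (List (Step d))).Finite :=
        (List.finite_length_le (Step d) N).subset fun w hw => hw.2
      have := hfin.fintype
      rw [hx, gf, tsum_fintype]
      exact ENNReal.sum_ne_top.2 fun w _ => ENNReal.pow_ne_top hz
    have hsub : {w | w ∈ noTurnBridges o ∧ w.length ≤ N} ⊆
        {[]} ∪ {w | (w ∈ noTurnBridges o ∧ w.length ≤ N) ∧ w ≠ []} := by
      intro w hw
      by_cases h : w = []
      · exact Or.inl h
      · exact Or.inr ⟨hw, h⟩
    have hdec : ∀ w : List (Step d), ∃ u v, IsBridge o w → w ≠ [] →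
        w = u ++ v ∧ IsIrreducible o u ∧ IsBridge o v := by
      intro w
      by_cases h : IsBridge o w ∧ w ≠ []
      · obtain ⟨u, v, huv⟩ := exists_irreducible_append h.1 h.2
        exact ⟨u, v, fun _ _ => huv⟩
      · exact ⟨[], [], fun h1 h2 => absurd ⟨h1, h2⟩ h⟩
    choose u v huv using hdec
    have hmul : z ^ 0 * gf z {w | (w ∈ noTurnBridges o ∧ w.length ≤ N) ∧ w ≠ []} ≤ a * x := by
      refine gf_le_mul 0 (fun w => (u w, v w)) ?_ ?_ ?_ ?_
      · intro s hs t ht h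
        simp only [Prod.mk.injEq] at h
        rw [(huv s hs.1.1.2.2 hs.2).1, (huv t ht.1.1.2.2 ht.2).1, h.1, h.2]
      · intro w hw
        obtain ⟨h1, h2, h3⟩ := huv w hw.1.1.2.2 hw.2
        obtain ⟨⟨⟨h4, h5, -⟩, -⟩, -⟩ := hw
        rw [h1] at h4 h5
        exact ⟨h4.left, h5.left, h2⟩
      · intro w hw
        obtain ⟨h1, h2, h3⟩ := huv w hw.1.1.2.2 hw.2
        obtain ⟨⟨⟨h4, h5, -⟩, h6⟩, -⟩ := hw
        rw [h1] at h4 h5 h6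
        rw [List.length_append] at h6
        exact ⟨⟨h4.right, h5.right, h3⟩, (Nat.le_add_left _ _).trans h6⟩
      · intro w hw
        conv_rhs => rw [(huv w hw.1.1.2.2 hw.2).1]
        simp
    rw [pow_zero, one_mul] at hmul
    have hle : x ≤ 1 + a * x := by
      refine (gf_mono z hsub).trans ((gf_union_le _ _ _).trans (add_le_add ?_ hmul))
      simp [gf]
    have h1 : x * (1 - a) ≤ 1 := by
      rw [ENNReal.mul_sub (fun _ _ => hxfin), mul_one, mul_comm]
      exact tsub_le_iff_right.2 hle
    rw [ENNReal.le_inv_iff_mul_le]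
    exact h1
  rw [gf, ENNReal.tsum_eq_iSup_sum]
  refine iSup_le fun s => ?_
  refine le_trans ?_ (htr (s.sup fun w => w.1.length))
  have hmem : ∀ w ∈ s, w.1 ∈ {w | w ∈ noTurnBridges o ∧
      w.length ≤ s.sup fun w => w.1.length} := fun w hw =>
    ⟨w.2, Finset.le_sup (f := fun w : noTurnBridges o => w.1.length) hw⟩
  have : ∑ w ∈ s, z ^ w.1.length =
      ∑ w ∈ s.attach.image (fun w => (⟨w.1.1, hmem w.1 w.2⟩ : {w | w ∈ noTurnBridges o ∧
        w.length ≤ s.sup fun w => w.1.length})), z ^ w.1.length := by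
    rw [Finset.sum_image, Finset.sum_attach s (fun w => z ^ w.1.length)]
    intro a _ b _ hab
    simp only [Subtype.mk.injEq] at hab
    exact Subtype.ext (Subtype.ext hab)
  rw [this]
  exact ENNReal.sum_le_tsum _

theorem eq_of_irreducible_append {o : Fin d} {u v u' v' : List (Step d)}
    (hu : IsIrreducible o u) (hu' : IsIrreducible o u') (hv : IsBridge o v) (hv' : IsBridge o v')
    (h : u ++ v = u' ++ v') : u = u' ∧ v = v' := by
  have key : ∀ {a t b : List (Step d)}, IsBridge o a → a ≠ [] → IsIrreducible o (a ++ t) →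
      IsBridge o (t ++ b) → t = [] := by
    intro a t b ha ha0 hat htb
    refine (hat.2.2 a t rfl ha ⟨htb.1.left, fun p hp => ?_⟩).resolve_left ha0
    have := hat.1.2 (a ++ p) ((List.prefix_append_right_inj _).2 hp)
    simpa using this
  rcases List.append_eq_append_iff.1 h with ⟨t, h1, h2⟩ | ⟨t, h1, h2⟩
  · subst h1 h2
    have := key hu.1 hu.2.1 hu' hv
    simp [this]
  · subst h1 h2
    have := key hu'.1 hu'.2.1 hu hv'
    simp [this]

theorem gf_irreducibles_lt_one (z : ℝ≥0∞) (o : Fin d) (hz : gf z (bridges o) ≠ ∞) :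
    gf z (irreducibles o) < 1 := by
  have h1 : 1 + gf z (irreducibles o) * gf z (bridges o) ≤ gf z (bridges o) := by
    rw [gf_mul_gf]
    let g : Unit ⊕ (irreducibles o × bridges o) → bridges o := fun x => match x with
      | .inl _ => ⟨[], isSAW_nil, isBridge_nil o⟩
      | .inr x => ⟨x.1.1 ++ x.2.1, x.1.2.2.1.isSAW_append x.2.2.2.1 x.1.2.1 x.2.2.1,
          x.1.2.2.1.append x.2.2.2⟩
    have hg : Function.Injective g := by
      rintro (_ | x) (_ | y) h
      · rfl
      · have : [] = y.1.1 ++ y.2.1 := congrArg Subtype.val h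
        exact absurd (List.append_eq_nil_iff.1 this.symm).1 y.1.2.2.2.1
      · have : x.1.1 ++ x.2.1 = [] := congrArg Subtype.val h
        exact absurd (List.append_eq_nil_iff.1 this).1 x.1.2.2.2.1
      · have : x.1.1 ++ x.2.1 = y.1.1 ++ y.2.1 := congrArg Subtype.val h
        obtain ⟨h2, h3⟩ := eq_of_irreducible_append x.1.2.2 y.1.2.2 x.2.2.2 y.2.2.2 this
        exact congrArg Sum.inr (Prod.ext (Subtype.ext h2) (Subtype.ext h3))
    have := ENNReal.tsum_comp_le_tsum_of_injective hg (fun w : bridges o => z ^ w.1.length)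
    refine le_trans (le_of_eq ?_) this
    rw [Summable.tsum_sum ENNReal.summable ENNReal.summable]
    simp [g]
  by_contra hcon
  rw [not_lt] at hcon
  have h2 : 1 + gf z (bridges o) ≤ gf z (bridges o) := by
    refine le_trans (add_le_add_right ?_ 1) h1
    calc gf z (bridges o) = 1 * gf z (bridges o) := (one_mul _).symm
      _ ≤ _ := mul_le_mul_left hcon _
  rw [add_comm] at h2
  exact absurd h2 (not_le.2 (ENNReal.lt_add_right hz one_ne_zero))

theorem gf_ne_top_of_lt {z : ℝ} (hz0 : 0 < z) (o : Fin d) (hz : z < (connectiveConstant d)⁻¹)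
    {A : Set (List (Step d))} (hA : ∀ w ∈ A, IsSAW w) : gf (ENNReal.ofReal z) A ≠ ∞ := by
  classical
  have hmu : 0 < connectiveConstant d := zero_lt_one.trans_le (one_le_connectiveConstant o)
  have h1 : connectiveConstant d < z⁻¹ := (lt_inv_comm₀ hz0 hmu).1 hz
  obtain ⟨b, hb1, hb2⟩ := exists_between h1
  obtain ⟨K, hK, hcK⟩ := exists_card_le_mul_pow o hb1
  have hb0 : 0 < b := hmu.trans hb1
  have hbz : b * z < 1 := by
    rw [lt_inv_comm₀ hb0 hz0, ← one_div, lt_div_iff₀ hb0] at hb2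
    linarith
  rw [gf_eq_tsum _ _ hA]
  have hs : Summable fun n : ℕ => K * (b * z) ^ n :=
    (summable_geometric_of_lt_one (by positivity) hbz).mul_left K
  refine ne_top_of_le_ne_top (hs.tsum_ofReal_ne_top) (ENNReal.tsum_le_tsum fun n => ?_)
  rw [← ENNReal.ofReal_pow hz0.le, ← ENNReal.ofReal_natCast, ← ENNReal.ofReal_mul (by positivity)]
  refine ENNReal.ofReal_le_ofReal ?_
  have h2 : (({w ∈ saws d n | w ∈ A}).card : ℝ) ≤ K * b ^ n :=
    le_trans (by exact_mod_cast Finset.card_filter_le _ _) (hcK n)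
  calc _ ≤ K * b ^ n * z ^ n := mul_le_mul_of_nonneg_right h2 (by positivity)
    _ = _ := by ring

/-- At the critical point, irreducible bridges have total weight at most one. -/
theorem gf_irreducibles_le_one (o : Fin d) :
    gf (ENNReal.ofReal (connectiveConstant d)⁻¹) (irreducibles o) ≤ 1 := by
  have hmu : 0 < connectiveConstant d := zero_lt_one.trans_le (one_le_connectiveConstant o)
  set zc := (connectiveConstant d)⁻¹ with hzc
  have hzc0 : 0 < zc := inv_pos.2 hmu
  rw [gf, ENNReal.tsum_eq_iSup_sum]
  refine iSup_le fun s => ?_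
  have hcont : Filter.Tendsto (fun z : ℝ => ∑ w ∈ s, ENNReal.ofReal z ^ w.1.length)
      (nhdsWithin zc (Set.Iio zc)) (nhds (∑ w ∈ s, ENNReal.ofReal zc ^ w.1.length)) := by
    refine Filter.Tendsto.mono_left ?_ nhdsWithin_le_nhds
    refine tendsto_finsetSum s fun w _ => ?_
    exact ((ENNReal.continuous_pow _).comp ENNReal.continuous_ofReal).tendsto zc
  refine le_of_tendsto hcont ?_
  have hev : ∀ᶠ z in nhdsWithin zc (Set.Iio zc), 0 < z :=
    (lt_mem_nhds hzc0).filter_mono nhdsWithin_le_nhds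
  filter_upwards [hev, self_mem_nhdsWithin] with z hz0 hz1
  exact (ENNReal.sum_le_tsum s).trans
    (gf_irreducibles_lt_one _ o (gf_ne_top_of_lt hz0 o hz1 fun w hw => hw.1)).le

/-! ### Self-avoiding words without U-turns are exponentially rare -/

/-- An irreducible bridge that contains a U-turn. -/
theorem exists_irreducible_with_turn {o o' : Fin d} (h : o' ≠ o) :
    ∃ w, w ∈ irreducibles o ∧ w ∉ noTurnIrreducibles o := by
  have h1 : ∀ e : ℤˣ, vec ((o, e) : Step d) o = e := fun e => by simp [vec]
  have h2 : ∀ e : ℤˣ, vec ((o, e) : Step d) o' = 0 := fun e => by simp [vec, h]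
  have h3 : ∀ e : ℤˣ, vec ((o', e) : Step d) o = 0 := fun e => by simp [vec, h.symm]
  have h4 : ∀ e : ℤˣ, vec ((o', e) : Step d) o' = e := fun e => by simp [vec]
  have hopp : opp ((o, 1) : Step d) = (o, -1) := rfl
  refine ⟨[(o, 1), (o, 1), (o', 1), (o, -1), (o', 1), (o, 1)], ⟨?_, ⟨?_, ?_⟩, by simp, ?_⟩, ?_⟩
  · refine List.Nodup.of_map (fun y => (y o, y o')) ?_
    simp only [verts_cons, verts_nil, List.map_cons, List.map_nil, Pi.add_apply, h1, h2, h3, h4,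
      Pi.zero_apply]
    decide
  · intro p hp hne
    simp only [List.prefix_cons_iff, List.prefix_nil] at hp
    rcases hp with rfl | ⟨_, rfl, rfl | ⟨_, rfl, rfl | ⟨_, rfl, rfl | ⟨_, rfl, rfl | ⟨_, rfl, rfl |
      ⟨_, rfl, rfl⟩⟩⟩⟩⟩⟩ <;> simp [h1, h3] at hne ⊢
  · intro p hp
    simp only [List.prefix_cons_iff, List.prefix_nil] at hp
    rcases hp with rfl | ⟨_, rfl, rfl | ⟨_, rfl, rfl | ⟨_, rfl, rfl | ⟨_, rfl, rfl | ⟨_, rfl, rfl |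
      ⟨_, rfl, rfl⟩⟩⟩⟩⟩⟩ <;> simp [h1, h3]
  · intro u v huv hu hv
    have hp : u <+: [(o, 1), (o, 1), (o', 1), (o, -1), (o', 1), (o, 1)] := ⟨v, huv.symm⟩
    simp only [List.prefix_cons_iff, List.prefix_nil] at hp
    rcases hp with rfl | ⟨_, rfl, rfl | ⟨_, rfl, rfl | ⟨_, rfl, rfl | ⟨_, rfl, rfl | ⟨_, rfl, rfl |
      ⟨_, rfl, rfl⟩⟩⟩⟩⟩⟩ <;>
      simp only [List.cons_append, List.nil_append, List.cons.injEq, true_and, List.nil_eq] at huv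
    · exact Or.inl rfl
    · have := hv.1 [(o, 1), (o', 1), (o, -1)] ⟨[(o', 1), (o, 1)], by rw [← huv]; rfl⟩ (by simp)
      simp [h1, h3] at this
    · have := hv.1 [(o', 1)] ⟨[(o, -1), (o', 1), (o, 1)], by rw [← huv]; rfl⟩ (by simp)
      simp [h3] at this
    · have := hv.1 [(o, -1)] ⟨[(o', 1), (o, 1)], by rw [← huv]; rfl⟩ (by simp)
      simp [h1] at this
    · have := hv.1 [(o', 1)] ⟨[(o, 1)], by rw [← huv]; rfl⟩ (by simp)
      simp [h3] at this
    · have := hu.2 [(o, 1), (o, 1)] ⟨[(o', 1), (o, -1), (o', 1)], rfl⟩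
      simp [h1, h3] at this
    · exact Or.inr huv
  · intro hmem
    exact hmem.2.1 [(o, 1)] (o, 1) (o', 1) [(o', 1), (o, 1)] rfl

open Classical in
/-- If words without U-turns had the same growth rate as all self-avoiding words, their generating
function would diverge at the critical point. It converges there, because removing the irreducible
bridges with a U-turn leaves a total weight strictly less than one. -/
theorem exists_card_noTurn_lt {o o' : Fin d} (h : o' ≠ o) :
    ∃ m, 1 ≤ m ∧ (({w ∈ saws d m | NoTurn w}).card : ℝ) < connectiveConstant d ^ m := by
  by_contra hcon
  push Not at hcon
  have hmu : 0 < connectiveConstant d := zero_lt_one.trans_le (one_le_connectiveConstant o)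
  set zr := (connectiveConstant d)⁻¹ with hzr
  have hzr0 : 0 < zr := inv_pos.2 hmu
  set z := ENNReal.ofReal zr with hz
  have hz0 : z ≠ 0 := by simpa [hz] using hzr0
  have hztop : z ≠ ∞ := ENNReal.ofReal_ne_top
  have hI : gf z (noTurnIrreducibles o) < 1 := by
    obtain ⟨w, hw1, hw2⟩ := exists_irreducible_with_turn h
    have h1 : gf z (noTurnIrreducibles o) + z ^ w.length ≤ 1 := by
      refine le_trans ?_ (gf_irreducibles_le_one o)
      let g : noTurnIrreducibles o ⊕ Unit → irreducibles o := fun x => match x with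
        | .inl x => ⟨x.1, x.2.1, x.2.2.2⟩
        | .inr _ => ⟨w, hw1⟩
      have hg : Function.Injective g := by
        rintro (x | _) (y | _) hxy
        · exact congrArg Sum.inl (Subtype.ext (congrArg (fun a => a.1) hxy :))
        · have : x.1 = w := congrArg Subtype.val hxy
          exact absurd (this ▸ x.2) hw2
        · have : w = y.1 := congrArg Subtype.val hxy
          exact absurd (this ▸ y.2) hw2
        · rfl
      have := ENNReal.tsum_comp_le_tsum_of_injective hg (fun w : irreducibles o => z ^ w.1.length)
      refine le_trans (le_of_eq ?_) this
      rw [Summable.tsum_sum ENNReal.summable ENNReal.summable]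
      simp [g, gf]
    refine lt_of_lt_of_le (ENNReal.lt_add_right ?_ (pow_ne_zero _ hz0)) h1
    exact ne_top_of_le_ne_top ENNReal.one_ne_top (le_self_add.trans h1)
  have hB : gf z (noTurnBridges o) ≠ ∞ := by
    refine ne_top_of_le_ne_top ?_ (gf_noTurnBridges_le z o hztop)
    rw [ENNReal.inv_ne_top]
    exact (tsub_pos_of_lt hI).ne'
  have hH : gf z (noTurnHalf o) ≠ ∞ :=
    ne_top_of_le_ne_top ENNReal.ofReal_ne_top (gf_noTurnHalf_le z o hB)
  have hC : gf z (noTurnWords d) ≠ ∞ := by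
    intro htop
    have := mul_gf_noTurnWords_le z o
    rw [htop, pow_one, ENNReal.mul_top hz0, top_le_iff] at this
    exact ENNReal.mul_ne_top hH hH this
  apply hC
  rw [gf_eq_tsum z _ fun w hw => hw.1, ← top_le_iff,
    ← ENNReal.tsum_const_eq_top_of_ne_zero (α := ℕ) one_ne_zero]
  refine ENNReal.tsum_le_tsum fun n => ?_
  have hcard : connectiveConstant d ^ n ≤ (({w ∈ saws d n | w ∈ noTurnWords d}).card : ℝ) := by
    have heq : ({w ∈ saws d n | w ∈ noTurnWords d}) = {w ∈ saws d n | NoTurn w} := by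
      refine Finset.filter_congr fun w hw => ?_
      exact ⟨fun h => h.2, fun h => ⟨(mem_saws.1 hw).2, h⟩⟩
    rw [heq]
    rcases Nat.eq_zero_or_pos n with rfl | hn
    · have : 0 < ({w ∈ saws d 0 | NoTurn w}).card :=
        Finset.card_pos.2 ⟨[], by simp [isSAW_nil, NoTurn]⟩
      rw [pow_zero]
      exact_mod_cast this
    · exact hcon n hn
  rw [hz, ← ENNReal.ofReal_pow hzr0.le, ← ENNReal.ofReal_natCast,
    ← ENNReal.ofReal_mul (by positivity), ENNReal.one_le_ofReal, hzr, inv_pow,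
    ← div_eq_mul_inv, one_le_div (by positivity)]
  exact hcard

/-! ### Counting U-turns -/

/-- The number of U-turns in a word. -/
def numTurns : List (Step d) → ℕ
  | a :: b :: c :: l => (if c = opp a then 1 else 0) + numTurns (b :: c :: l)
  | _ => 0

theorem numTurns_cons_three (a b c : Step d) (l : List (Step d)) :
    numTurns (a :: b :: c :: l) = (if c = opp a then 1 else 0) + numTurns (b :: c :: l) := by
  rw [numTurns]

@[simp] theorem numTurns_nil : numTurns ([] : List (Step d)) = 0 := rfl
@[simp] theorem numTurns_one (a : Step d) : numTurns [a] = 0 := rfl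
@[simp] theorem numTurns_two (a b : Step d) : numTurns [a, b] = 0 := rfl

theorem numTurns_le_cons (a : Step d) (l : List (Step d)) : numTurns l ≤ numTurns (a :: l) := by
  rcases l with _ | ⟨b, _ | ⟨c, l⟩⟩
  · simp
  · simp
  · rw [numTurns_cons_three]; omega

theorem numTurns_cons_le (a : Step d) (l : List (Step d)) :
    numTurns (a :: l) ≤ numTurns l + 1 := by
  rcases l with _ | ⟨b, _ | ⟨c, l⟩⟩
  · simp
  · simp
  · rw [numTurns_cons_three]; split_ifs <;> omega

theorem numTurns_add_le (u v : List (Step d)) : numTurns u + numTurns v ≤ numTurns (u ++ v) := by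
  induction u with
  | nil => simp
  | cons a u ih =>
    rcases u with _ | ⟨b, _ | ⟨c, u⟩⟩
    · simpa using numTurns_le_cons a v
    · simpa using (numTurns_le_cons b v).trans (numTurns_le_cons a _)
    · simp only [List.cons_append, numTurns_cons_three] at ih ⊢
      omega

theorem numTurns_append_le (u v : List (Step d)) :
    numTurns (u ++ v) ≤ numTurns u + numTurns v + 2 := by
  induction u with
  | nil => simp
  | cons a u ih =>
    rcases u with _ | ⟨b, _ | ⟨c, u⟩⟩
    · have := numTurns_cons_le a v
      simp; omega
    · have := numTurns_cons_le b v
      have := numTurns_cons_le a (b :: v)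
      simp; omega
    · simp only [List.cons_append, numTurns_cons_three] at ih ⊢
      omega

theorem noTurn_of_numTurns_eq_zero {w : List (Step d)} (h : numTurns w = 0) : NoTurn w := by
  rintro p s f q rfl
  have h1 := numTurns_add_le p (s :: f :: opp s :: q)
  rw [h, numTurns_cons_three, if_pos rfl] at h1
  omega

/-- Weighting each U-turn by a small `t` lowers the growth rate. As the weighted count is
submultiplicative and tends to the count of words without U-turns as `t → 0`, this follows from
the strict inequality at a single length. -/
theorem exists_sum_pow_numTurns_le {o o' : Fin d} (h : o' ≠ o) :
    ∃ t b K : ℝ, 0 < t ∧ t < 1 ∧ 0 < b ∧ b < connectiveConstant d ∧ 0 < K ∧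
      ∀ n, ∑ w ∈ saws d n, t ^ numTurns w ≤ K * b ^ n := by
  classical
  obtain ⟨m, hm, hlt⟩ := exists_card_noTurn_lt h
  set x : ℝ := (({w ∈ saws d m | NoTurn w}).card : ℝ) with hx
  have hc : (0 : ℝ) < (saws d m).card := by exact_mod_cast saws_card_pos o m
  obtain ⟨t, ht0, ht1, htm⟩ : ∃ t : ℝ, 0 < t ∧ t < 1 ∧
      x + t * (saws d m).card < connectiveConstant d ^ m := by
    refine ⟨min (1 / 2) ((connectiveConstant d ^ m - x) / (2 * (saws d m).card)), ?_, ?_, ?_⟩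
    · have : 0 < connectiveConstant d ^ m - x := by linarith
      positivity
    · exact (min_le_left _ _).trans_lt (by norm_num)
    · have h1 := mul_le_mul_of_nonneg_right (min_le_right (1 / 2 : ℝ)
        ((connectiveConstant d ^ m - x) / (2 * (saws d m).card))) hc.le
      have h2 : (connectiveConstant d ^ m - x) / (2 * (saws d m).card) * (saws d m).card =
          (connectiveConstant d ^ m - x) / 2 := by field_simp
      linarith
  have hx0 : 0 ≤ x := by positivity
  have hy0 : 0 < x + t * (saws d m).card := by positivity
  have hpow : ((x + t * (saws d m).card) ^ ((m : ℝ)⁻¹)) ^ m = x + t * (saws d m).card :=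
    Real.rpow_inv_natCast_pow hy0.le (by omega)
  have hb0 : 0 < (x + t * (saws d m).card) ^ ((m : ℝ)⁻¹) := Real.rpow_pos_of_pos hy0 _
  have hZ : ∑ w ∈ saws d m, t ^ numTurns w ≤
      ((x + t * (saws d m).card) ^ ((m : ℝ)⁻¹)) ^ m := by
    rw [hpow]
    calc ∑ w ∈ saws d m, t ^ numTurns w
        ≤ ∑ w ∈ saws d m, ((if NoTurn w then 1 else 0) + t) := by
          refine Finset.sum_le_sum fun w _ => ?_
          by_cases h0 : numTurns w = 0
          · rw [if_pos (noTurn_of_numTurns_eq_zero h0), h0, pow_zero]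
            linarith
          · refine (pow_le_of_le_one ht0.le ht1.le h0).trans ?_
            split_ifs <;> linarith
      _ = _ := by
          rw [Finset.sum_add_distrib, Finset.sum_const, nsmul_eq_mul, Finset.sum_ite]
          simp [hx, mul_comm]
  obtain ⟨K, hK, hKn⟩ := exists_le_mul_pow_of_submul (f := fun n => ∑ w ∈ saws d n, t ^ numTurns w)
    (fun n => Finset.sum_nonneg fun w _ => by positivity)
    (sum_saws_add_le (fun w => t ^ numTurns w) (fun w => by positivity) fun u v => by
      rw [← pow_add]
      exact pow_le_pow_of_le_one ht0.le ht1.le (numTurns_add_le u v)) hb0 hm hZ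
  refine ⟨t, _, K, ht0, ht1, hb0, ?_, hK, hKn⟩
  refine lt_of_pow_lt_pow_left₀ m (zero_le_one.trans (one_le_connectiveConstant o)) ?_
  rw [hpow]
  exact htm

/-! ### Inserting and removing U-turns -/

/-- A word `p ++ f :: q` with a distinguished step `f`, together with a step `s`. It encodes both
the insertion of a U-turn `s, f, -s` in place of `f` and the converse removal. -/
abbrev Move (d : ℕ) := List (Step d) × Step d × Step d × List (Step d)

instance : DecidableEq (Move d) :=
  @instDecidableEqProd (List (Step d)) (Step d × Step d × List (Step d)) _ _

/-- The word of a move with the U-turn `s, f, -s` present. -/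
def long (r : Move d) : List (Step d) := r.1 ++ r.2.1 :: r.2.2.1 :: opp r.2.1 :: r.2.2.2

/-- The word of a move with the U-turn replaced by its middle step. -/
def short (r : Move d) : List (Step d) := r.1 ++ r.2.2.1 :: r.2.2.2

@[simp] theorem disp_long (r : Move d) : disp (long r) = disp (short r) := by
  simp only [long, short, disp_append, disp_cons, vec_opp]; abel

theorem length_long (r : Move d) : (long r).length = (short r).length + 2 := by
  simp [long, short]; omega

theorem vec_ne_zero (s : Step d) : vec s ≠ 0 := by
  obtain ⟨a, e⟩ := s
  intro h
  have := congrFun h a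
  simp [vec] at this

theorem verts_long_perm (a b : List (Step d)) (r : Move d) :
    (verts 0 (a ++ long r ++ b)).Perm
      ((disp a + disp r.1 + vec r.2.1) :: (disp a + disp r.1 + vec r.2.1 + vec r.2.2.1) ::
        verts 0 (a ++ short r ++ b)) := by
  obtain ⟨p, s, f, q⟩ := r
  have h1 : verts 0 (a ++ long (p, s, f, q) ++ b) = path 0 (a ++ p) ++
      (disp a + disp p) :: (disp a + disp p + vec s) :: (disp a + disp p + vec s + vec f) ::
        verts (disp a + disp p + vec f) (q ++ b) := by
    have : a ++ long (p, s, f, q) ++ b = (a ++ p) ++ s :: f :: opp s :: (q ++ b) := by simp [long]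
    rw [this, verts_append]
    have he : disp a + disp p + vec s + vec f + -vec s = disp a + disp p + vec f := by abel
    simp only [verts_cons, disp_append, zero_add, vec_opp, he]
  have h2 : verts 0 (a ++ short (p, s, f, q) ++ b) = path 0 (a ++ p) ++
      (disp a + disp p) :: verts (disp a + disp p + vec f) (q ++ b) := by
    have : a ++ short (p, s, f, q) ++ b = (a ++ p) ++ f :: (q ++ b) := by simp [short]
    rw [this, verts_append]
    simp only [verts_cons, disp_append, zero_add]
  rw [h1, h2]
  generalize path 0 (a ++ p) = l
  generalize verts (disp a + disp p + vec f) (q ++ b) = m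
  have h3 : ∀ (x y z : Fin d → ℤ), (l ++ x :: y :: z :: m).Perm (y :: z :: (l ++ x :: m)) := by
    intro x y z
    have h4 : (l ++ x :: y :: z :: m) = (l ++ [x]) ++ y :: z :: m := by simp
    have h5 : (l ++ x :: m) = (l ++ [x]) ++ m := by simp
    rw [h4, h5]
    exact List.perm_middle.trans (List.perm_middle.cons _)
  exact h3 _ _ _

theorem isSAW_long_iff (a b : List (Step d)) (r : Move d) :
    IsSAW (a ++ long r ++ b) ↔ IsSAW (a ++ short r ++ b) ∧
      disp a + disp r.1 + vec r.2.1 ∉ verts 0 (a ++ short r ++ b) ∧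
      disp a + disp r.1 + vec r.2.1 + vec r.2.2.1 ∉ verts 0 (a ++ short r ++ b) := by
  rw [IsSAW, (verts_long_perm a b r).nodup_iff, List.nodup_cons, List.nodup_cons, List.mem_cons,
    not_or, IsSAW]
  have : disp a + disp r.1 + vec r.2.1 ≠ disp a + disp r.1 + vec r.2.1 + vec r.2.2.1 := by
    intro h
    exact vec_ne_zero r.2.2.1 (by simpa using h)
  tauto

/-- Removing a U-turn preserves self-avoidance. -/
theorem IsSAW.short {a b : List (Step d)} {r : Move d} (h : IsSAW (a ++ long r ++ b)) :
    IsSAW (a ++ short r ++ b) := ((isSAW_long_iff a b r).1 h).1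

/-- The move `r` with a step `a` put in front of its word. -/
def Move.cons (a : Step d) (r : Move d) : Move d := (a :: r.1, r.2)

theorem Move.cons_injective (a : Step d) : Function.Injective (Move.cons a) := by
  rintro ⟨p, x⟩ ⟨q, y⟩ h
  simpa [Move.cons] using h

/-- The U-turns of a word. -/
def turnSet : List (Step d) → Finset (Move d)
  | a :: b :: c :: l =>
    (if c = opp a then {([], a, b, l)} else ∅) ∪ (turnSet (b :: c :: l)).image (Move.cons a)
  | _ => ∅

theorem mem_turnSet {w : List (Step d)} {r : Move d} : r ∈ turnSet w ↔ long r = w := by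
  induction w generalizing r with
  | nil => simp [turnSet, long]
  | cons a w ih =>
    rcases w with _ | ⟨b, _ | ⟨c, l⟩⟩
    · obtain ⟨_ | ⟨x, p⟩, s, f, q⟩ := r <;> simp [turnSet, long]
    · obtain ⟨_ | ⟨x, _ | ⟨y, p⟩⟩, s, f, q⟩ := r <;> simp [turnSet, long]
    · rw [turnSet, Finset.mem_union, Finset.mem_image]
      obtain ⟨_ | ⟨x, p⟩, s, f, q⟩ := r
      · split_ifs with h
        · subst h
          simp [long, Move.cons]
          grind
        · simp only [Finset.notMem_empty, false_or, Move.cons, Prod.mk.injEq, reduceCtorEq,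
            false_and, and_false, exists_false, long, List.nil_append, List.cons.injEq, false_iff]
          rintro ⟨rfl, rfl, rfl, -⟩
          exact h rfl
      · have : (([] : List (Step d)), a, b, l) ≠ (x :: p, s, f, q) := by simp
        have h1 : (x :: p, s, f, q) ∉ (if c = opp a then {([], a, b, l)} else ∅ :
            Finset (Move d)) := by
          split_ifs <;> simp
        simp only [h1, false_or, ih]
        constructor
        · rintro ⟨r, hr, he⟩
          simp only [Move.cons, Prod.mk.injEq, List.cons.injEq] at he
          obtain ⟨⟨rfl, rfl⟩, h2⟩ := he
          rw [← hr]
          simp [long, h2]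
        · intro he
          simp only [long, List.cons_append, List.cons.injEq] at he
          exact ⟨(p, s, f, q), he.2, by simp [Move.cons, he.1]⟩

theorem card_turnSet (w : List (Step d)) : (turnSet w).card = numTurns w := by
  induction w with
  | nil => rfl
  | cons a w ih =>
    rcases w with _ | ⟨b, _ | ⟨c, l⟩⟩
    · rfl
    · rfl
    · rw [turnSet, numTurns_cons_three, ← ih, Finset.card_union_of_disjoint,
        Finset.card_image_of_injective _ (Move.cons_injective a)]
      · split_ifs <;> simp
      · rw [Finset.disjoint_left]
        intro r hr hr2
        obtain ⟨x, -, rfl⟩ := Finset.mem_image.1 hr2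
        split_ifs at hr <;> simp [Move.cons] at hr

/-- All the moves whose short word is the given one. -/
def shortSet : List (Step d) → Finset (Move d)
  | [] => ∅
  | a :: w => (Finset.univ.image fun s => ([], s, a, w)) ∪ (shortSet w).image (Move.cons a)

theorem mem_shortSet {w : List (Step d)} {r : Move d} : r ∈ shortSet w ↔ short r = w := by
  induction w generalizing r with
  | nil => simp [shortSet, short]
  | cons a w ih =>
    rw [shortSet, Finset.mem_union, Finset.mem_image, Finset.mem_image]
    obtain ⟨_ | ⟨x, p⟩, s, f, q⟩ := r
    · simp [short, Move.cons]
      grind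
    · simp only [Finset.mem_univ, true_and, Prod.mk.injEq, reduceCtorEq, false_and, exists_false,
        false_or, ih]
      constructor
      · rintro ⟨r, hr, he⟩
        simp only [Move.cons, Prod.mk.injEq, List.cons.injEq] at he
        obtain ⟨⟨rfl, rfl⟩, h2⟩ := he
        rw [← hr]
        simp [short, h2]
      · intro he
        simp only [short, List.cons_append, List.cons.injEq] at he
        exact ⟨(p, s, f, q), he.2, by simp [Move.cons, he.1]⟩

/-- The U-turns that can be inserted in the piece `u` of the word `a ++ u ++ b` without destroying
self-avoidance. -/
def insSet (a u b : List (Step d)) : Finset (Move d) :=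
  {r ∈ shortSet u | IsSAW (a ++ long r ++ b)}

theorem mem_insSet {a u b : List (Step d)} {r : Move d} :
    r ∈ insSet a u b ↔ short r = u ∧ IsSAW (a ++ long r ++ b) := by
  simp [insSet, mem_shortSet]

/-- The number of U-turns that can be inserted in the piece `u` of `a ++ u ++ b`. -/
def numIns (a u b : List (Step d)) : ℕ := (insSet a u b).card

/-- The positions in space of the possible insertions. Unlike the moves themselves, these do not
change when the word is modified elsewhere. -/
def insPos (a u b : List (Step d)) : Finset ((Fin d → ℤ) × Step d × Step d) :=
  (insSet a u b).image fun r => (disp a + disp r.1, r.2.1, r.2.2.1)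

theorem card_insPos (a u b : List (Step d)) : (insPos a u b).card = numIns a u b := by
  refine Finset.card_image_of_injOn ?_
  rintro ⟨p, s, f, q⟩ hr ⟨p', s', f', q'⟩ hr' h
  simp only [Prod.mk.injEq, add_right_inj] at h
  obtain ⟨h1, h2⟩ := mem_insSet.1 hr
  obtain ⟨h3, -⟩ := mem_insSet.1 hr'
  have h5 := h2.short
  rw [List.append_assoc] at h5
  have h6 := (h5.right).left
  rw [← h3] at h1
  obtain ⟨h7, h8⟩ := IsSAW.eq_of_disp_eq h6 h1 h.1
  simp only [List.cons.injEq] at h8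
  dsimp only at h7
  simp [h, h7, h8.2]

/-- The bound on the local effect of a single move on the numbers of U-turns and of possible
insertions. -/
def moveConst (d : ℕ) : ℕ := 5 * Fintype.card (Step d × Step d)

/-- Removing a U-turn creates a bounded number of new insertions: those next to one of the two
points that become free, and those at the shortened bond. -/
theorem numIns_short_le {a b : List (Step d)} {r₀ : Move d} (h₀ : IsSAW (a ++ long r₀ ++ b)) :
    numIns a (short r₀) b ≤ numIns a (long r₀) b + moveConst d := by
  classical
  set P := disp a + disp r₀.1 with hP
  set R₁ := P + vec r₀.2.1 with hR₁
  set R₂ := R₁ + vec r₀.2.2.1 with hR₂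
  let F : Fin 5 → Step d × Step d → (Fin d → ℤ) × Step d × Step d := fun i x => match i with
    | 0 => (P, x)
    | 1 => (R₁ - vec x.1, x)
    | 2 => (R₂ - vec x.1, x)
    | 3 => (R₁ - vec x.2 - vec x.1, x)
    | 4 => (R₂ - vec x.2 - vec x.1, x)
  have hF : ∀ i x y, F i x = y → y ∈ (Finset.univ : Finset (Fin 5 × (Step d × Step d))).image
      (fun z => F z.1 z.2) := fun i x y h => Finset.mem_image.2 ⟨(i, x), Finset.mem_univ _, h⟩
  have hsub : insPos a (short r₀) b ⊆ insPos a (long r₀) b ∪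
      (Finset.univ : Finset (Fin 5 × (Step d × Step d))).image (fun z => F z.1 z.2) := by
    intro y hy
    obtain ⟨r, hr, rfl⟩ := Finset.mem_image.1 hy
    obtain ⟨hs, hsaw⟩ := mem_insSet.1 hr
    rw [isSAW_long_iff, hs] at hsaw
    obtain ⟨-, hY₁, hY₂⟩ := hsaw
    rw [Finset.mem_union]
    by_cases hpos : ∃ r' : Move d, short r' = long r₀ ∧ disp r'.1 = disp r.1 ∧ r'.2.1 = r.2.1 ∧
        r'.2.2.1 = r.2.2.1
    · obtain ⟨r', h1, h2, h3, h4⟩ := hpos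
      have hmem : ∀ y, y ∈ verts 0 (a ++ long r₀ ++ b) ↔
          y = R₁ ∨ y = R₂ ∨ y ∈ verts 0 (a ++ short r₀ ++ b) := by
        intro y
        rw [(verts_long_perm a b r₀).mem_iff, List.mem_cons, List.mem_cons]
      by_cases hY₁' : disp a + disp r.1 + vec r.2.1 ∈ verts 0 (a ++ long r₀ ++ b)
      · right
        rcases (hmem _).1 hY₁' with h | h | h
        · exact hF 1 (r.2.1, r.2.2.1) _ (Prod.ext (sub_eq_of_eq_add h.symm) rfl)
        · exact hF 2 (r.2.1, r.2.2.1) _ (Prod.ext (sub_eq_of_eq_add h.symm) rfl)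
        · exact absurd h hY₁
      · by_cases hY₂' : disp a + disp r.1 + vec r.2.1 + vec r.2.2.1 ∈
            verts 0 (a ++ long r₀ ++ b)
        · right
          rcases (hmem _).1 hY₂' with h | h | h
          · exact hF 3 (r.2.1, r.2.2.1) _
              (Prod.ext (sub_eq_of_eq_add (sub_eq_of_eq_add h.symm)) rfl)
          · exact hF 4 (r.2.1, r.2.2.1) _
              (Prod.ext (sub_eq_of_eq_add (sub_eq_of_eq_add h.symm)) rfl)
          · exact absurd h hY₂
        · left
          refine Finset.mem_image.2 ⟨r', mem_insSet.2 ⟨h1, ?_⟩, by rw [h2, h3, h4]⟩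
          rw [isSAW_long_iff, h1, h2, h3, h4]
          exact ⟨h₀, hY₁', hY₂'⟩
    · right
      have hp : r.1 = r₀.1 := by
        by_contra hne
        apply hpos
        obtain ⟨p, s, f, q⟩ := r
        obtain ⟨p₀, s₀, f₀, q₀⟩ := r₀
        simp only [short] at hs
        rcases List.append_eq_append_iff.1 hs with ⟨t, ht1, ht2⟩ | ⟨t, ht1, ht2⟩
        · rcases t with _ | ⟨x, t⟩
          · simp [ht1] at hne
          · simp only [List.cons_append, List.cons.injEq] at ht2
            obtain ⟨rfl, rfl⟩ := ht2
            exact ⟨(p, s, f, t ++ s₀ :: f₀ :: opp s₀ :: q₀), by simp [short, long, ht1],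
              rfl, rfl, rfl⟩
        · rcases t with _ | ⟨x, t⟩
          · simp [ht1] at hne
          · simp only [List.cons_append, List.cons.injEq] at ht2
            obtain ⟨rfl, rfl⟩ := ht2
            refine ⟨(p₀ ++ s₀ :: f₀ :: opp s₀ :: t, s, f, q), by simp [short, long],
              ?_, rfl, rfl⟩
            simp only [ht1, disp_append, disp_cons, vec_opp]
            abel
      exact hF 0 (r.2.1, r.2.2.1) _ (by simp [F, hP, hp])
  rw [← card_insPos, ← card_insPos]
  refine (Finset.card_le_card hsub).trans ((Finset.card_union_le _ _).trans ?_)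
  refine Nat.add_le_add_left (Finset.card_image_le.trans ?_) _
  simp [moveConst]

theorem five_le_moveConst (o : Fin d) : 5 ≤ moveConst d := by
  have : 0 < Fintype.card (Step d × Step d) := Fintype.card_pos_iff.2 ⟨((o, 1), (o, 1))⟩
  rw [moveConst]; omega

theorem numIns_long_left_le (r : Move d) (u b : List (Step d)) :
    numIns (long r) u b ≤ numIns (short r) u b := by
  refine Finset.card_le_card fun x hx => ?_
  rw [mem_insSet] at hx ⊢
  refine ⟨hx.1, ?_⟩
  have h := hx.2
  rw [← List.nil_append (long r), List.append_assoc] at h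
  have := h.short
  rwa [List.nil_append, ← List.append_assoc] at this

theorem numIns_long_right_le (a u : List (Step d)) (r : Move d) :
    numIns a u (long r) ≤ numIns a u (short r) := by
  refine Finset.card_le_card fun x hx => ?_
  rw [mem_insSet] at hx ⊢
  refine ⟨hx.1, ?_⟩
  have h := hx.2
  rw [← List.append_nil (a ++ long x ++ long r)] at h
  have := h.short
  rwa [List.append_nil] at this

theorem numTurns_long_le (o : Fin d) (r : Move d) :
    numTurns (long r) ≤ numTurns (short r) + moveConst d := by
  obtain ⟨p, s, f, q⟩ := r
  have h1 := numTurns_append_le p (s :: f :: opp s :: q)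
  have h2 := numTurns_cons_le s (f :: opp s :: q)
  have h3 := numTurns_cons_le f (opp s :: q)
  have h4 := numTurns_cons_le (opp s) q
  have h5 := numTurns_add_le p (f :: q)
  have h6 := numTurns_le_cons f q
  have h7 := five_le_moveConst o
  simp only [long, short]
  omega

/-! ### Double counting of moves -/

/-- Weighted double counting: if the edges of a bipartite graph end in `B`, and the target of
each edge has degree at most `g` of its source, then the degrees of the sources divided by `g` add
up to at most the size of `B`. -/
theorem sum_card_fiber_div_le {ε α β : Type*} [DecidableEq α] [DecidableEq β] (E : Finset ε)
    (src : ε → α) (tgt : ε → β) {A : Finset α} {B : Finset β} (hA : ∀ e ∈ E, src e ∈ A)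
    (hB : ∀ e ∈ E, tgt e ∈ B) (g : α → ℝ)
    (hg : ∀ e ∈ E, ((E.filter fun e' => tgt e' = tgt e).card : ℝ) ≤ g (src e)) :
    ∑ w ∈ A, ((E.filter fun e => src e = w).card : ℝ) / g w ≤ B.card := by
  have h1 : ∑ w ∈ A, ((E.filter fun e => src e = w).card : ℝ) / g w = ∑ e ∈ E, 1 / g (src e) := by
    rw [← Finset.sum_fiberwise_of_maps_to hA]
    refine Finset.sum_congr rfl fun w _ => ?_
    rw [Finset.sum_congr rfl (g := fun _ => 1 / g w), Finset.sum_const, nsmul_eq_mul, mul_one_div]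
    intro e he
    rw [(Finset.mem_filter.1 he).2]
  rw [h1, ← Finset.sum_fiberwise_of_maps_to hB, Finset.card_eq_sum_ones, Nat.cast_sum]
  refine Finset.sum_le_sum fun y _ => ?_
  rcases (E.filter fun e => tgt e = y).eq_empty_or_nonempty with h | h
  · rw [h]; simp
  · have hc : (0 : ℝ) < (E.filter fun e => tgt e = y).card := by
      exact_mod_cast Finset.card_pos.2 h
    calc ∑ e ∈ E.filter fun e => tgt e = y, 1 / g (src e)
        ≤ ∑ e ∈ E.filter fun e => tgt e = y, 1 / ((E.filter fun e => tgt e = y).card : ℝ) := by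
          refine Finset.sum_le_sum fun e he => ?_
          obtain ⟨he1, he2⟩ := Finset.mem_filter.1 he
          have := hg e he1
          rw [he2] at this
          exact one_div_le_one_div_of_le hc this
      _ = _ := by
          rw [Finset.sum_const, nsmul_eq_mul]
          field_simp
          simp

/-- The self-avoiding words cut into three pieces of prescribed lengths. -/
noncomputable def triples (d α k β : ℕ) :
    Finset (List (Step d) × List (Step d) × List (Step d)) :=
  {x ∈ saws d α ×ˢ saws d k ×ˢ saws d β | IsSAW (x.1 ++ x.2.1 ++ x.2.2)}

theorem mem_triples {α k β : ℕ} {x : List (Step d) × List (Step d) × List (Step d)} :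
    x ∈ triples d α k β ↔ x.1.length = α ∧ x.2.1.length = k ∧ x.2.2.length = β ∧
      IsSAW (x.1 ++ x.2.1 ++ x.2.2) := by
  simp only [triples, Finset.mem_filter, Finset.mem_product, mem_saws]
  constructor
  · tauto
  · rintro ⟨h1, h2, h3, h4⟩
    exact ⟨⟨⟨h1, h4.left.left⟩, ⟨h2, h4.left.right⟩, h3, h4.right⟩, h4⟩

theorem card_triples_le (α k β : ℕ) : (triples d α k β).card ≤ (saws d (α + k + β)).card := by
  refine Finset.card_le_card_of_injOn (fun x => x.1 ++ x.2.1 ++ x.2.2) ?_ ?_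
  · intro x hx
    obtain ⟨h1, h2, h3, h4⟩ := mem_triples.1 hx
    exact mem_saws.2 ⟨by simp [h1, h2, h3]; omega, h4⟩
  · rintro ⟨a, p, b⟩ hx ⟨a', p', b'⟩ hx' h
    obtain ⟨h1, h2, h3, -⟩ := mem_triples.1 hx
    obtain ⟨h1', h2', h3', -⟩ := mem_triples.1 hx'
    dsimp only at *
    rw [List.append_assoc, List.append_assoc] at h
    obtain ⟨h5, h6⟩ := List.append_inj h (by omega)
    obtain ⟨h7, h8⟩ := List.append_inj h6 (by omega)
    rw [h5, h7, h8]

/-- The triples whose middle piece has at least `u` U-turns but at most `i` insertions. -/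
noncomputable def fewIns (d α k β u i : ℕ) :
    Finset (List (Step d) × List (Step d) × List (Step d)) :=
  {x ∈ triples d α k β | u ≤ numTurns x.2.1 ∧ numIns x.1 x.2.1 x.2.2 ≤ i}

/-- Removing one of the many U-turns leads to words that still have few insertions, and each of
these is reached only a few times. -/
theorem card_fewIns_mul_le (o : Fin d) (α k β u i : ℕ) :
    (fewIns d α (k + 2) β (u + moveConst d) i).card * (u + moveConst d) ≤
      (fewIns d α k β u (i + moveConst d)).card * (i + moveConst d) := by
  set c := moveConst d with hc
  have hc5 := five_le_moveConst o
  let E := (fewIns d α (k + 2) β (u + c) i).sigma fun x => turnSet x.2.1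
  let tgt : (Σ _ : List (Step d) × List (Step d) × List (Step d), Move d) →
      List (Step d) × List (Step d) × List (Step d) := fun e => (e.1.1, short e.2, e.1.2.2)
  have hE : ∀ e ∈ E, e.1 ∈ fewIns d α (k + 2) β (u + c) i ∧ long e.2 = e.1.2.1 := fun e he =>
    ⟨(Finset.mem_sigma.1 he).1, mem_turnSet.1 (Finset.mem_sigma.1 he).2⟩
  have hbnd : ∀ e ∈ E, numIns e.1.1 (short e.2) e.1.2.2 ≤ i + c := by
    intro e he
    obtain ⟨h1, h2⟩ := hE e he
    obtain ⟨h3, -, h4⟩ := Finset.mem_filter.1 h1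
    have h5 := (mem_triples.1 h3).2.2.2
    rw [← h2] at h4 h5
    exact (numIns_short_le h5).trans (Nat.add_le_add_right h4 _)
  have key := sum_card_fiber_div_le E Sigma.fst tgt (A := fewIns d α (k + 2) β (u + c) i)
    (B := fewIns d α k β u (i + c)) (fun e he => (hE e he).1) ?_ (fun _ => ((i + c : ℕ) : ℝ)) ?_
  · have h1 : ∀ w ∈ fewIns d α (k + 2) β (u + c) i,
        ((u + c : ℕ) : ℝ) / ((i + c : ℕ) : ℝ) ≤
          ((E.filter fun e => e.1 = w).card : ℝ) / ((i + c : ℕ) : ℝ) := by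
      intro w hw
      refine div_le_div_of_nonneg_right ?_ (by positivity)
      have h2 : (turnSet w.2.1).card ≤ (E.filter fun e => e.1 = w).card := by
        refine Finset.card_le_card_of_injOn (fun r => ⟨w, r⟩) ?_ ?_
        · intro r hr
          exact Finset.mem_filter.2 ⟨Finset.mem_sigma.2 ⟨hw, hr⟩, rfl⟩
        · intro r _ r' _ h
          simpa using h
      rw [card_turnSet] at h2
      exact_mod_cast (Finset.mem_filter.1 hw).2.1.trans h2
    have h2 := (Finset.sum_le_sum h1).trans key
    rw [Finset.sum_const, nsmul_eq_mul, ← mul_div_assoc, div_le_iff₀ (by positivity)] at h2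
    exact_mod_cast h2
  · intro e he
    obtain ⟨h1, h2⟩ := hE e he
    obtain ⟨h3, h4, -⟩ := Finset.mem_filter.1 h1
    obtain ⟨h5, h6, h7, h8⟩ := mem_triples.1 h3
    have h9 := hbnd e he
    rw [← h2] at h4 h6 h8
    refine Finset.mem_filter.2 ⟨mem_triples.2 ⟨h5, ?_, h7, h8.short⟩, ?_, h9⟩
    · rw [length_long] at h6
      simpa [tgt] using h6
    · have := numTurns_long_le o e.2
      simp only [tgt]
      omega
  · intro e he
    have h1 : (E.filter fun e' => tgt e' = tgt e).card ≤ numIns e.1.1 (short e.2) e.1.2.2 := by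
      refine Finset.card_le_card_of_injOn (fun e' => e'.2) ?_ ?_
      · intro e' he'
        obtain ⟨h2, h3⟩ := Finset.mem_filter.1 he'
        simp only [tgt, Prod.mk.injEq] at h3
        obtain ⟨h4, h5⟩ := hE e' h2
        have h6 := (mem_triples.1 (Finset.mem_filter.1 h4).1).2.2.2
        rw [← h5, h3.1, h3.2.2] at h6
        exact mem_insSet.2 ⟨h3.2.1, h6⟩
      · rintro ⟨⟨a, p, b⟩, r⟩ he1 ⟨⟨a', p', b'⟩, r'⟩ he2 h
        obtain ⟨h2, h3⟩ := Finset.mem_filter.1 he1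
        obtain ⟨h2', h3'⟩ := Finset.mem_filter.1 he2
        have h4 := (hE _ h2).2
        have h4' := (hE _ h2').2
        simp only [tgt, Prod.mk.injEq] at h3 h3' h h4 h4'
        subst h
        rw [h4] at h4'
        subst h4'
        rw [h3.1, h3.2.2, h3'.1, h3'.2.2]
    exact_mod_cast h1.trans (hbnd e he)

/-- Iteration of `card_fewIns_mul_le` over `J` removals. -/
theorem card_fewIns_mul_pow_le (o : Fin d) (α k β v i J : ℕ) :
    (fewIns d α (k + 2 * J) β (v + moveConst d * J) i).card * v ^ J ≤
      (i + moveConst d * J) ^ J * (saws d (α + k + β)).card := by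
  induction J generalizing i with
  | zero =>
    simp only [mul_zero, add_zero, pow_zero, mul_one, one_mul]
    exact (Finset.card_filter_le _ _).trans (card_triples_le α k β)
  | succ J ih =>
    set c := moveConst d
    have h1 := card_fewIns_mul_le o α (k + 2 * J) β (v + c * J) i
    have h2 := ih (i + c)
    change _ * (v + c * J + c) ≤ _ at h1
    have e1 : k + 2 * (J + 1) = k + 2 * J + 2 := by ring
    have e2 : v + c * (J + 1) = v + c * J + c := by ring
    have e3 : i + c * (J + 1) = i + c + c * J := by ring
    rw [e1, e2, e3]
    calc (fewIns d α (k + 2 * J + 2) β (v + c * J + c) i).card * v ^ (J + 1)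
        = (fewIns d α (k + 2 * J + 2) β (v + c * J + c) i).card * v * v ^ J := by ring
      _ ≤ (fewIns d α (k + 2 * J + 2) β (v + c * J + c) i).card * (v + c * J + c) * v ^ J := by
          gcongr; omega
      _ ≤ (fewIns d α (k + 2 * J) β (v + c * J) (i + c)).card * (i + c) * v ^ J := by gcongr
      _ = (i + c) * ((fewIns d α (k + 2 * J) β (v + c * J) (i + c)).card * v ^ J) := by ring
      _ ≤ (i + c) * ((i + c + c * J) ^ J * (saws d (α + k + β)).card) := by gcongr
      _ ≤ (i + c + c * J) * ((i + c + c * J) ^ J * (saws d (α + k + β)).card) :=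
          Nat.mul_le_mul_right _ (Nat.le_add_right _ _)
      _ = _ := by ring

/-! ### Words with few U-turns or few insertions are exponentially rare -/

/-- The words cut into three pieces whose middle piece has few U-turns or few insertions. -/
noncomputable def badTriples (d : ℕ) (δ : ℝ) (α k β : ℕ) :
    Finset (List (Step d) × List (Step d) × List (Step d)) :=
  {x ∈ triples d α k β | (numTurns x.2.1 : ℝ) < δ * (α + k + β : ℕ) ∨
    (numIns x.1 x.2.1 x.2.2 : ℝ) < δ * (α + k + β : ℕ)}

/-- A Chernoff bound: in all but an exponentially small proportion of the words, a middle piece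
which takes up at least a quarter of the length has linearly many U-turns. -/
theorem exists_card_fewTurns_le {o o' : Fin d} (h : o' ≠ o) :
    ∃ δ s K : ℝ, 0 < δ ∧ 0 < s ∧ s < 1 ∧ 0 < K ∧ ∀ α k β : ℕ, α + k + β ≤ 4 * k →
      (({x ∈ triples d α k β | (numTurns x.2.1 : ℝ) < δ * (α + k + β : ℕ)}).card : ℝ) ≤
        K * (s * connectiveConstant d) ^ (α + k + β) := by
  obtain ⟨t, b, K₁, ht0, ht1, hb0, hb, hK₁, hZ⟩ := exists_sum_pow_numTurns_le h
  set μ := connectiveConstant d with hμ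
  have hμ0 : 0 < μ := hb0.trans hb
  set s : ℝ := (b / μ) ^ ((12 : ℕ) : ℝ)⁻¹ with hs
  have hbμ : b / μ < 1 := (div_lt_one hμ0).2 hb
  have hbμ0 : 0 < b / μ := by positivity
  have hs0 : 0 < s := Real.rpow_pos_of_pos hbμ0 _
  have hs1 : s < 1 := Real.rpow_lt_one hbμ0.le hbμ (by norm_num)
  have hs12 : s ^ 12 = b / μ := Real.rpow_inv_natCast_pow hbμ0.le (by norm_num)
  obtain ⟨K₂, hK₂, hc⟩ := exists_card_le_mul_pow o (b := μ / s)
    (by rw [lt_div_iff₀ hs0]; nlinarith)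
  refine ⟨Real.log s / Real.log t, s, K₂ * K₁ * K₂,
    div_pos_of_neg_of_neg (Real.log_neg hs0 hs1) (Real.log_neg ht0 ht1), hs0, hs1, by positivity,
    fun α k β hk => ?_⟩
  set n := α + k + β with hn
  set δ := Real.log s / Real.log t with hδ
  have htδ : t ^ δ = s := by
    rw [Real.rpow_def_of_pos ht0, hδ, mul_div_cancel₀ _ (Real.log_neg ht0 ht1).ne,
      Real.exp_log hs0]
  set F := ({x ∈ triples d α k β | (numTurns x.2.1 : ℝ) < δ * (n : ℕ)} :
    Finset (List (Step d) × List (Step d) × List (Step d)))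
  have h1 : (F.card : ℝ) * s ^ n ≤ ∑ x ∈ F, t ^ numTurns x.2.1 := by
    rw [← nsmul_eq_mul, ← Finset.sum_const]
    refine Finset.sum_le_sum fun x hx => ?_
    have hx2 := (Finset.mem_filter.1 hx).2
    rw [← htδ, ← Real.rpow_mul_natCast ht0.le, ← Real.rpow_natCast t (numTurns _)]
    exact Real.rpow_le_rpow_of_exponent_ge ht0 ht1.le hx2.le
  have h2 : ∑ x ∈ F, t ^ numTurns x.2.1 ≤
      (saws d α).card * ((∑ w ∈ saws d k, t ^ numTurns w) * (saws d β).card) := by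
    calc ∑ x ∈ F, t ^ numTurns x.2.1
        ≤ ∑ x ∈ saws d α ×ˢ saws d k ×ˢ saws d β, t ^ numTurns x.2.1 := by
          refine Finset.sum_le_sum_of_subset_of_nonneg ?_ fun x _ _ => by positivity
          exact (Finset.filter_subset _ _).trans (Finset.filter_subset _ _)
      _ = _ := by
          rw [Finset.sum_product]
          simp only [Finset.sum_product, Finset.sum_const, nsmul_eq_mul]
          rw [← Finset.mul_sum, mul_comm (saws d β).card.cast]
  have h3 : (saws d α).card * ((∑ w ∈ saws d k, t ^ numTurns w) * (saws d β).card) ≤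
      K₂ * (μ / s) ^ α * ((K₁ * b ^ k) * (K₂ * (μ / s) ^ β)) := by
    gcongr
    · exact hc α
    · exact hZ k
    · exact hc β
  have h4 : b ^ k * (μ / s) ^ (α + β) * s ^ n ≤ μ ^ n * s ^ (2 * n) * s ^ n := by
    have hb' : b = s ^ 12 * μ := by rw [hs12]; field_simp
    have e1 : b ^ k * (μ / s) ^ (α + β) * s ^ n = μ ^ n * s ^ (12 * k) * s ^ k := by
      have : s ^ n = s ^ (α + β) * s ^ k := by rw [← pow_add]; congr 1; omega
      rw [this, hb', div_pow, hn]
      field_simp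
      ring
    rw [e1, mul_assoc, mul_assoc, ← pow_add, ← pow_add]
    refine mul_le_mul_of_nonneg_left ?_ (by positivity)
    exact pow_le_pow_of_le_one hs0.le hs1.le (by omega)
  have h5 : b ^ k * (μ / s) ^ (α + β) ≤ μ ^ n * s ^ (2 * n) :=
    le_of_mul_le_mul_right h4 (by positivity)
  have h6 : (F.card : ℝ) * s ^ n ≤ (K₂ * K₁ * K₂ * (s * μ) ^ n) * s ^ n := by
    calc (F.card : ℝ) * s ^ n ≤ _ := h1.trans (h2.trans h3)
      _ = K₂ * K₁ * K₂ * (b ^ k * (μ / s) ^ (α + β)) := by ring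
      _ ≤ K₂ * K₁ * K₂ * (μ ^ n * s ^ (2 * n)) := by gcongr
      _ = _ := by ring
  exact le_of_mul_le_mul_right h6 (by positivity)

/-- In all but an exponentially small proportion of the words, a middle piece which takes up at
least a quarter of the length has linearly many U-turns and linearly many insertions. -/
theorem exists_card_badTriples_le {o o' : Fin d} (h : o' ≠ o) :
    ∃ δ ρ K : ℝ, 0 < δ ∧ 0 < ρ ∧ ρ < 1 ∧ 0 < K ∧ ∀ α k β : ℕ, α + k + β ≤ 4 * k →
      ((badTriples d δ α k β).card : ℝ) ≤ K * (ρ * connectiveConstant d) ^ (α + k + β) := by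
  obtain ⟨ε₀, s, K₁, hε₀, hs0, hs1, hK₁, hfew⟩ := exists_card_fewTurns_le h
  set μ := connectiveConstant d with hμ
  have hμ1 : 1 ≤ μ := one_le_connectiveConstant o
  have hμ0 : 0 < μ := by linarith
  set c := moveConst d with hc
  set ε := min ε₀ (1 / 2) with hε
  have hε0 : 0 < ε := by positivity
  have hε1 : ε ≤ 1 / 2 := min_le_right _ _
  set δ := ε / (4 * (1 + c)) with hδ
  have hδ0 : 0 < δ := by positivity
  have hδc : δ * (1 + c) = ε / 4 := by rw [hδ]; field_simp
  have hcδ : 0 ≤ δ * c := by positivity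
  set r : ℝ := (1 / 2 : ℝ) ^ (δ / 2) with hr
  have hr0 : 0 < r := by positivity
  have hr1 : r < 1 := Real.rpow_lt_one (by norm_num) (by norm_num) (by positivity)
  obtain ⟨K₂, hK₂, hcn⟩ := exists_card_le_mul_pow o (b := μ / r)
    (by rw [lt_div_iff₀ hr0]; nlinarith)
  refine ⟨δ, max s r, K₁ + 2 * K₂, hδ0, by positivity, max_lt hs1 hr1, by positivity,
    fun α k β hk => ?_⟩
  set n := α + k + β with hn
  set J := ⌊δ * n⌋₊ with hJ
  have hJ1 : (J : ℝ) ≤ δ * n := Nat.floor_le (by positivity)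
  have hJ2 : δ * n < J + 1 := Nat.lt_floor_add_one _
  have hδ8 : δ ≤ 1 / 8 := by linarith
  have hJk : 2 * J ≤ k := by
    have h1 : (n : ℝ) ≤ 4 * k := by exact_mod_cast hk
    have : (2 * J : ℝ) ≤ k := by nlinarith
    exact_mod_cast this
  obtain ⟨k', hk'⟩ := Nat.exists_eq_add_of_le' hJk
  set u := ⌈ε * n⌉₊ with hu
  have hu1 : ε * n ≤ u := Nat.le_ceil _
  have hcJ : (c * J : ℝ) ≤ ε / 4 * n := by
    have h1 : (c : ℝ) * J ≤ c * (δ * n) := by gcongr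
    have h2 : c * (δ * n) = (δ * c) * n := by ring
    have h3 : δ * c * n ≤ ε / 4 * n := by
      refine mul_le_mul_of_nonneg_right ?_ (by positivity)
      linarith
    linarith
  have hn0 : (0 : ℝ) ≤ n := by positivity
  have hcu : c * J ≤ u := by
    have : (c * J : ℝ) ≤ u := by nlinarith
    exact_mod_cast this
  obtain ⟨v, hv⟩ := Nat.exists_eq_add_of_le' hcu
  have hv1 : ε / 2 * n ≤ v := by
    have : (u : ℝ) = v + c * J := by exact_mod_cast hv
    nlinarith
  -- the words with many U-turns and few insertions
  have hB2 : ((fewIns d α k β u J).card : ℝ) ≤ 2 * K₂ * (r * μ) ^ n := by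
    have h1 := card_fewIns_mul_pow_le o α k' β v J J
    rw [← hk', ← hc, ← hv] at h1
    have h1' : ((fewIns d α k β u J).card : ℝ) * (v : ℝ) ^ J ≤
        (J + c * J : ℝ) ^ J * (saws d (α + k' + β)).card := by exact_mod_cast h1
    have h2 : (J + c * J : ℝ) ≤ 1 / 2 * v := by
      have : (J + c * J : ℝ) ≤ (1 + c) * (δ * n) := by
        have := mul_le_mul_of_nonneg_left hJ1 (by positivity : (0 : ℝ) ≤ 1 + c)
        linarith
      have e : (1 + c) * (δ * n) = ε / 4 * n := by rw [← hδc]; ring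
      linarith
    have h3 : ((fewIns d α k β u J).card : ℝ) ≤ (1 / 2) ^ J * (saws d (α + k' + β)).card := by
      rcases Nat.eq_zero_or_pos J with h0 | h0
      · rw [h0] at h1' ⊢
        simpa using h1'
      · have hv0 : (0 : ℝ) < v := by
          have : (0 : ℝ) < J := by exact_mod_cast h0
          have : (0 : ℝ) ≤ c * J := by positivity
          linarith
        have h4 : ((fewIns d α k β u J).card : ℝ) * (v : ℝ) ^ J ≤
            (1 / 2) ^ J * (saws d (α + k' + β)).card * (v : ℝ) ^ J := by
          calc _ ≤ (J + c * J : ℝ) ^ J * (saws d (α + k' + β)).card := h1'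
            _ ≤ (1 / 2 * v : ℝ) ^ J * (saws d (α + k' + β)).card :=
                mul_le_mul_of_nonneg_right (pow_le_pow_left₀ (by positivity) h2 J)
                  (Nat.cast_nonneg _)
            _ = _ := by rw [mul_pow]; ring
        exact le_of_mul_le_mul_right h4 (by positivity)
    have h5 : ((1 : ℝ) / 2) ^ J ≤ 2 * (r ^ 2) ^ n := by
      have e1 : (r ^ 2) ^ n = (1 / 2 : ℝ) ^ (δ * n) := by
        rw [← pow_mul, hr, ← Real.rpow_mul_natCast (by norm_num)]
        congr 1
        push_cast
        ring
      have e2 : ((1 : ℝ) / 2) ^ (J + 1) ≤ (1 / 2 : ℝ) ^ (δ * n) := by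
        rw [← Real.rpow_natCast]
        refine Real.rpow_le_rpow_of_exponent_ge (by norm_num) (by norm_num) ?_
        push_cast
        linarith
      rw [e1]
      rw [pow_succ] at e2
      linarith
    have h6 : ((saws d (α + k' + β)).card : ℝ) ≤ K₂ * (μ / r) ^ n := by
      refine (hcn _).trans (mul_le_mul_of_nonneg_left ?_ hK₂.le)
      refine pow_le_pow_right₀ ?_ (by omega)
      rw [le_div_iff₀ hr0]
      linarith
    calc ((fewIns d α k β u J).card : ℝ) ≤ _ := h3
      _ ≤ (2 * (r ^ 2) ^ n) * (K₂ * (μ / r) ^ n) :=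
          mul_le_mul h5 h6 (Nat.cast_nonneg _) (by positivity)
      _ = _ := by rw [div_pow]; field_simp; ring
  have hsub : badTriples d δ α k β ⊆
      {x ∈ triples d α k β | (numTurns x.2.1 : ℝ) < ε₀ * (n : ℕ)} ∪ fewIns d α k β u J := by
    intro x hx
    obtain ⟨hx1, hx2⟩ := Finset.mem_filter.1 hx
    rw [Finset.mem_union, Finset.mem_filter, fewIns, Finset.mem_filter]
    have hδε : δ ≤ ε := by linarith
    by_cases h1 : (numTurns x.2.1 : ℝ) < ε * n
    · left
      refine ⟨hx1, h1.trans_le ?_⟩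
      gcongr
      exact min_le_left _ _
    · right
      rw [not_lt] at h1
      refine ⟨hx1, Nat.ceil_le.2 h1, ?_⟩
      rcases hx2 with h2 | h2
      · exfalso
        have : δ * n ≤ ε * n := by gcongr
        linarith
      · exact Nat.le_floor h2.le
  have h1 : ((badTriples d δ α k β).card : ℝ) ≤ K₁ * (s * μ) ^ n + 2 * K₂ * (r * μ) ^ n := by
    have := (Finset.card_le_card hsub).trans (Finset.card_union_le _ _)
    have h2 : ((badTriples d δ α k β).card : ℝ) ≤
        (({x ∈ triples d α k β | (numTurns x.2.1 : ℝ) < ε₀ * (n : ℕ)}).card : ℝ) +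
          (fewIns d α k β u J).card := by exact_mod_cast this
    exact h2.trans (add_le_add (hfew α k β hk) hB2)
  refine h1.trans ?_
  rw [add_mul]
  gcongr
  · exact le_max_left _ _
  · exact le_max_right _ _

/-! ### Moving the index at which a walk visits a point -/

/-- The self-avoiding words of length `k + l` that are at `x` after `k` steps, cut there. -/
noncomputable def pairs (k l : ℕ) (x : Fin d → ℤ) : Finset (List (Step d) × List (Step d)) :=
  {y ∈ saws d k ×ˢ saws d l | IsSAW (y.1 ++ y.2) ∧ disp y.1 = x}

theorem mem_pairs {k l : ℕ} {x : Fin d → ℤ} {y : List (Step d) × List (Step d)} :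
    y ∈ pairs k l x ↔ y.1.length = k ∧ y.2.length = l ∧ IsSAW (y.1 ++ y.2) ∧ disp y.1 = x := by
  simp only [pairs, Finset.mem_filter, Finset.mem_product, mem_saws]
  constructor
  · tauto
  · rintro ⟨h1, h2, h3, h4⟩
    exact ⟨⟨⟨h1, h3.left⟩, h2, h3.right⟩, h3, h4⟩

/-- As a self-avoiding walk visits `x` at most once, the numbers of walks that visit `x` at the
different indices add up to at most the number of all walks. -/
theorem sum_card_pairs_le (n : ℕ) (x : Fin d → ℤ) :
    ∑ k ∈ Finset.range (n + 1), (pairs k (n - k) x).card ≤ (saws d n).card := by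
  rw [← Finset.card_sigma]
  refine Finset.card_le_card_of_injOn (fun e => e.2.1 ++ e.2.2) ?_ ?_
  · intro e he
    obtain ⟨h1, h2⟩ := Finset.mem_sigma.1 he
    obtain ⟨h3, h4, h5, -⟩ := mem_pairs.1 h2
    rw [Finset.mem_range] at h1
    exact mem_saws.2 ⟨by rw [List.length_append]; omega, h5⟩
  · rintro ⟨k, u, v⟩ he ⟨k', u', v'⟩ he' h
    obtain ⟨h3, -, h5, h6⟩ := mem_pairs.1 (Finset.mem_sigma.1 he).2
    obtain ⟨h3', -, -, h6'⟩ := mem_pairs.1 (Finset.mem_sigma.1 he').2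
    dsimp only at *
    obtain ⟨h7, h8⟩ := h5.eq_of_disp_eq h (h6.trans h6'.symm)
    subst h7 h8
    rw [h3] at h3'
    rw [h3']

/-- Words that visit `x` with one U-turn marked before this visit and one after it. Removing the
first or the second U-turn gives walks of the same length which visit `x` at indices that differ
by two. -/
noncomputable def markedPairs (k l : ℕ) (x : Fin d → ℤ) : Finset (Move d × Move d) :=
  (pairs (k + 2) (l + 2) x).biUnion fun y => turnSet y.1 ×ˢ turnSet y.2

theorem mem_markedPairs {k l : ℕ} {x : Fin d → ℤ} {e : Move d × Move d} :
    e ∈ markedPairs k l x ↔ (short e.1).length = k ∧ (short e.2).length = l ∧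
      IsSAW (long e.1 ++ long e.2) ∧ disp (short e.1) = x := by
  simp only [markedPairs, Finset.mem_biUnion, Finset.mem_product, mem_turnSet]
  constructor
  · rintro ⟨y, hy, h1, h2⟩
    obtain ⟨h3, h4, h5, h6⟩ := mem_pairs.1 hy
    rw [← h1, length_long] at h3
    rw [← h2, length_long] at h4
    rw [← h1, ← h2] at h5
    rw [← h1, disp_long] at h6
    exact ⟨by omega, by omega, h5, h6⟩
  · rintro ⟨h1, h2, h3, h4⟩
    refine ⟨(long e.1, long e.2), mem_pairs.2 ⟨?_, ?_, h3, ?_⟩, rfl, rfl⟩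
    · rw [length_long, h1]
    · rw [length_long, h2]
    · rw [disp_long, h4]

theorem isSAW_short_long {r₁ r₂ : Move d} (h : IsSAW (long r₁ ++ long r₂)) :
    IsSAW (short r₁ ++ long r₂) := by
  rw [← List.nil_append (long r₁)] at h
  simpa using h.short

theorem isSAW_long_short {r₁ r₂ : Move d} (h : IsSAW (long r₁ ++ long r₂)) :
    IsSAW (long r₁ ++ short r₂) := by
  rw [← List.append_nil (long r₁ ++ long r₂)] at h
  simpa using h.short

theorem short_long_mem_pairs {k l : ℕ} {x : Fin d → ℤ} {e : Move d × Move d}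
    (he : e ∈ markedPairs k l x) : (short e.1, long e.2) ∈ pairs k (l + 2) x := by
  obtain ⟨h1, h2, h3, h4⟩ := mem_markedPairs.1 he
  exact mem_pairs.2 ⟨h1, by rw [length_long, h2], isSAW_short_long h3, h4⟩

theorem long_short_mem_pairs {k l : ℕ} {x : Fin d → ℤ} {e : Move d × Move d}
    (he : e ∈ markedPairs k l x) : (long e.1, short e.2) ∈ pairs (k + 2) l x := by
  obtain ⟨h1, h2, h3, h4⟩ := mem_markedPairs.1 he
  exact mem_pairs.2 ⟨by rw [length_long, h1], h2, isSAW_long_short h3, by rw [disp_long, h4]⟩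

theorem card_fiber_short_long {k l : ℕ} {x : Fin d → ℤ} {w : List (Step d) × List (Step d)}
    (hw : w ∈ pairs k (l + 2) x) :
    ((markedPairs k l x).filter fun e => (short e.1, long e.2) = w).card =
      numIns [] w.1 w.2 * numTurns w.2 := by
  rw [numIns, ← card_turnSet, ← Finset.card_product]
  congr 1
  obtain ⟨h1, h2, h3, h4⟩ := mem_pairs.1 hw
  ext e
  rw [Finset.mem_filter, mem_markedPairs, Finset.mem_product, mem_insSet, mem_turnSet]
  constructor
  · rintro ⟨⟨h5, h6, h7, h8⟩, rfl⟩
    exact ⟨⟨rfl, h7⟩, rfl⟩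
  · rintro ⟨⟨h5, h6⟩, h7⟩
    rw [← h7, length_long] at h2
    rw [← h7, List.nil_append] at h6
    exact ⟨⟨by rw [h5, h1], by omega, h6, by rw [h5, h4]⟩, Prod.ext h5 h7⟩

theorem card_fiber_long_short {k l : ℕ} {x : Fin d → ℤ} {w : List (Step d) × List (Step d)}
    (hw : w ∈ pairs (k + 2) l x) :
    ((markedPairs k l x).filter fun e => (long e.1, short e.2) = w).card =
      numTurns w.1 * numIns w.1 w.2 [] := by
  rw [numIns, ← card_turnSet, ← Finset.card_product]
  congr 1
  obtain ⟨h1, h2, h3, h4⟩ := mem_pairs.1 hw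
  ext e
  rw [Finset.mem_filter, mem_markedPairs, Finset.mem_product, mem_insSet, mem_turnSet]
  constructor
  · rintro ⟨⟨h5, h6, h7, h8⟩, rfl⟩
    exact ⟨rfl, rfl, by simpa using h7⟩
  · rintro ⟨h7, h5, h6⟩
    rw [← h7, length_long] at h1
    rw [← h7, List.append_nil] at h6
    rw [← h7, disp_long] at h4
    exact ⟨⟨by omega, by rw [h5, h2], h6, h4⟩, Prod.ext h7 h5⟩

/-- Lower bound for the number of walks that visit `x` two steps later. -/
theorem sum_forward_le (o : Fin d) (k l : ℕ) (x : Fin d → ℤ) :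
    ∑ w ∈ pairs k (l + 2) x, ((numIns [] w.1 w.2 : ℝ) * numTurns w.2) /
      ((numTurns w.1 + moveConst d) * (numIns w.1 w.2 [] + moveConst d)) ≤
      (pairs (k + 2) l x).card := by
  refine le_trans (le_of_eq ?_) (sum_card_fiber_div_le (markedPairs k l x)
    (fun e => (short e.1, long e.2)) (fun e => (long e.1, short e.2))
    (fun e he => short_long_mem_pairs he) (fun e he => long_short_mem_pairs he)
    (fun w => ((numTurns w.1 + moveConst d : ℝ) * (numIns w.1 w.2 [] + moveConst d))) ?_)
  · refine Finset.sum_congr rfl fun w hw => ?_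
    rw [card_fiber_short_long hw]
    push_cast
    rfl
  · intro e he
    rw [card_fiber_long_short (long_short_mem_pairs he)]
    obtain ⟨-, -, h3, -⟩ := mem_markedPairs.1 he
    have h1 := numTurns_long_le o e.1
    have h2 : numIns (long e.1) (short e.2) [] ≤ numIns (long e.1) (long e.2) [] + moveConst d :=
      numIns_short_le (by simpa using h3)
    have h4 := numIns_long_left_le e.1 (long e.2) []
    have h5 := h2.trans (Nat.add_le_add_right h4 _)
    exact_mod_cast Nat.mul_le_mul h1 h5

/-- Lower bound for the number of walks that visit `x` two steps earlier. -/
theorem sum_backward_le (o : Fin d) (k l : ℕ) (x : Fin d → ℤ) :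
    ∑ w ∈ pairs (k + 2) l x, ((numTurns w.1 : ℝ) * numIns w.1 w.2 []) /
      ((numIns [] w.1 w.2 + moveConst d) * (numTurns w.2 + moveConst d)) ≤
      (pairs k (l + 2) x).card := by
  refine le_trans (le_of_eq ?_) (sum_card_fiber_div_le (markedPairs k l x)
    (fun e => (long e.1, short e.2)) (fun e => (short e.1, long e.2))
    (fun e he => long_short_mem_pairs he) (fun e he => short_long_mem_pairs he)
    (fun w => ((numIns [] w.1 w.2 + moveConst d : ℝ) * (numTurns w.2 + moveConst d))) ?_)
  · refine Finset.sum_congr rfl fun w hw => ?_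
    rw [card_fiber_long_short hw]
    push_cast
    rfl
  · intro e he
    rw [card_fiber_short_long (short_long_mem_pairs he)]
    obtain ⟨-, -, h3, -⟩ := mem_markedPairs.1 he
    have h1 := numTurns_long_le o e.2
    have h2 : numIns [] (short e.1) (long e.2) ≤ numIns [] (long e.1) (long e.2) + moveConst d :=
      numIns_short_le (by simpa using h3)
    have h4 := numIns_long_right_le [] (long e.1) e.2
    have h5 := h2.trans (Nat.add_le_add_right h4 _)
    exact_mod_cast Nat.mul_le_mul h5 h1

/-- The pairs in which both pieces have at least `M` U-turns and at least `M` insertions. -/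
noncomputable def goodPairs (M : ℝ) (k l : ℕ) (x : Fin d → ℤ) :
    Finset (List (Step d) × List (Step d)) :=
  {w ∈ pairs k l x | (M ≤ numTurns w.1 ∧ M ≤ numTurns w.2) ∧
    (M ≤ numIns [] w.1 w.2 ∧ M ≤ numIns w.1 w.2 [])}

/-- Approximate log-convexity in the index of the visit to `x`: by the Cauchy–Schwarz
inequality, the two lower bounds for the numbers of walks visiting `x` earlier and later multiply
to almost the square of the number of good walks. -/
theorem sq_card_goodPairs_le (o : Fin d) {M : ℝ} (hM : 0 < M) (k l : ℕ) (x : Fin d → ℤ) :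
    ((M / (M + moveConst d)) ^ 2 * (goodPairs M (k + 2) (l + 2) x).card) ^ 2 ≤
      ((pairs (k + 4) l x).card : ℝ) * (pairs k (l + 4) x).card := by
  set c : ℝ := (moveConst d : ℝ) with hc
  have hc0 : 0 ≤ c := by positivity
  set G := goodPairs M (k + 2) (l + 2) x with hG
  have hGsub : G ⊆ pairs (k + 2) (l + 2) x := Finset.filter_subset _ _
  let f : List (Step d) × List (Step d) → ℝ := fun w =>
    ((numIns [] w.1 w.2 : ℝ) * numTurns w.2) / ((numTurns w.1 + c) * (numIns w.1 w.2 [] + c))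
  let g : List (Step d) × List (Step d) → ℝ := fun w =>
    ((numTurns w.1 : ℝ) * numIns w.1 w.2 []) / ((numIns [] w.1 w.2 + c) * (numTurns w.2 + c))
  have hf0 : ∀ w, 0 ≤ f w := fun w => by positivity
  have hg0 : ∀ w, 0 ≤ g w := fun w => by positivity
  have hf : ∑ w ∈ G, f w ≤ (pairs (k + 4) l x).card :=
    (Finset.sum_le_sum_of_subset_of_nonneg hGsub fun w _ _ => hf0 w).trans
      (sum_forward_le o (k + 2) l x)
  have hg : ∑ w ∈ G, g w ≤ (pairs k (l + 4) x).card :=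
    (Finset.sum_le_sum_of_subset_of_nonneg hGsub fun w _ _ => hg0 w).trans
      (sum_backward_le o k (l + 2) x)
  have hratio : ∀ y : ℝ, M ≤ y → M / (M + c) ≤ y / (y + c) := by
    intro y hy
    rw [div_le_div_iff₀ (by positivity) (by linarith)]
    nlinarith
  have hq0 : 0 ≤ M / (M + c) := by positivity
  have hfg : ∀ w ∈ G, (M / (M + c)) ^ 2 ≤ √(f w) * √(g w) := by
    intro w hw
    obtain ⟨-, ⟨h1, h2⟩, h3, h4⟩ := Finset.mem_filter.1 hw
    rw [← Real.sqrt_mul (hf0 w)]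
    refine Real.le_sqrt_of_sq_le ?_
    have e : f w * g w = ((numIns [] w.1 w.2 : ℝ) / (numIns [] w.1 w.2 + c)) *
        ((numTurns w.2 : ℝ) / (numTurns w.2 + c)) * (((numTurns w.1 : ℝ) / (numTurns w.1 + c)) *
        ((numIns w.1 w.2 [] : ℝ) / (numIns w.1 w.2 [] + c))) := by
      simp only [f, g]
      rw [div_mul_div_comm, div_mul_div_comm, div_mul_div_comm, div_mul_div_comm]
      congr 1
      ring
    have e2 : ((M / (M + c)) ^ 2) ^ 2 =
        (M / (M + c)) * (M / (M + c)) * ((M / (M + c)) * (M / (M + c))) := by ring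
    rw [e, e2]
    exact mul_le_mul (mul_le_mul (hratio _ h3) (hratio _ h2) hq0 (by positivity))
      (mul_le_mul (hratio _ h1) (hratio _ h4) hq0 (by positivity)) (by positivity) (by positivity)
  have h1 : (M / (M + c)) ^ 2 * G.card ≤ ∑ w ∈ G, √(f w) * √(g w) := by
    rw [mul_comm, ← nsmul_eq_mul]
    exact Finset.card_nsmul_le_sum _ _ _ hfg
  calc ((M / (M + c)) ^ 2 * G.card) ^ 2 ≤ (∑ w ∈ G, √(f w) * √(g w)) ^ 2 :=
        pow_le_pow_left₀ (by positivity) h1 2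
    _ ≤ (∑ w ∈ G, √(f w) ^ 2) * ∑ w ∈ G, √(g w) ^ 2 := Finset.sum_mul_sq_le_sq_mul_sq _ _ _
    _ = (∑ w ∈ G, f w) * ∑ w ∈ G, g w := by
        simp only [Real.sq_sqrt (hf0 _), Real.sq_sqrt (hg0 _)]
    _ ≤ _ := mul_le_mul hf hg (Finset.sum_nonneg fun w _ => hg0 w) (by positivity)

theorem card_pairs_le (δ : ℝ) (k l : ℕ) (x : Fin d → ℤ) :
    (pairs k l x).card ≤ (goodPairs (δ * (k + l : ℕ)) k l x).card +
      ((badTriples d δ 0 k l).card + (badTriples d δ k l 0).card) := by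
  classical
  have hsub : pairs k l x ⊆ goodPairs (δ * (k + l : ℕ)) k l x ∪
      (((pairs k l x).filter fun w => ([], w.1, w.2) ∈ badTriples d δ 0 k l) ∪
        (pairs k l x).filter fun w => (w.1, w.2, []) ∈ badTriples d δ k l 0) := by
    intro w hw
    obtain ⟨h1, h2, h3, h4⟩ := mem_pairs.1 hw
    simp only [goodPairs, badTriples, Finset.mem_union, Finset.mem_filter, mem_triples, hw,
      h1, h2, List.append_nil, List.nil_append, h3, List.length_nil, true_and, and_true,
      zero_add, add_zero]
    by_cases h5 : δ * (k + l : ℕ) ≤ numTurns w.1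
    · by_cases h6 : δ * (k + l : ℕ) ≤ numTurns w.2
      · by_cases h7 : δ * (k + l : ℕ) ≤ numIns [] w.1 w.2
        · by_cases h8 : δ * (k + l : ℕ) ≤ numIns w.1 w.2 []
          · exact Or.inl ⟨⟨h5, h6⟩, h7, h8⟩
          · exact Or.inr (Or.inr (Or.inr (not_le.1 h8)))
        · exact Or.inr (Or.inl (Or.inr (not_le.1 h7)))
      · exact Or.inr (Or.inr (Or.inl (not_le.1 h6)))
    · exact Or.inr (Or.inl (Or.inl (not_le.1 h5)))
  refine (Finset.card_le_card hsub).trans ((Finset.card_union_le _ _).trans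
    (Nat.add_le_add_left ((Finset.card_union_le _ _).trans (Nat.add_le_add ?_ ?_)) _))
  · refine Finset.card_le_card_of_injOn (fun w => ([], w.1, w.2))
      (fun w hw => (Finset.mem_filter.1 hw).2) fun a _ b _ h => ?_
    simpa [Prod.ext_iff] using h
  · refine Finset.card_le_card_of_injOn (fun w => (w.1, w.2, []))
      (fun w hw => (Finset.mem_filter.1 hw).2) fun a _ b _ h => ?_
    simpa [Prod.ext_iff] using h

/-! ### Spreading of the visiting index -/

/-- A sequence that initially does not drop, and whose logarithm has second differences at least
of order `-D`, stays of the same order over `J` steps as long as `D * J ^ 2` is bounded. -/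
theorem half_le_of_almost_logConvex {g : ℕ → ℝ} {D τ : ℝ} {J : ℕ} (hD0 : 0 ≤ D)
    (hD : D * J ^ 2 ≤ 1 / 2) (hτ : 0 < τ) (h0 : 2 * τ ≤ g 0) (h1 : (1 - D) * g 0 ≤ g 1)
    (hg : ∀ j, j + 1 < J → τ ≤ g (j + 1) → ((1 - D) * g (j + 1)) ^ 2 ≤ g (j + 2) * g j) :
    ∀ j, j < J → g 0 / 2 ≤ g j := by
  have hJ1 : ∀ j, j < J → D * (j : ℝ) ^ 2 ≤ 1 / 2 := by
    intro j hj
    refine le_trans ?_ hD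
    have : (j : ℝ) ≤ J := by exact_mod_cast hj.le
    gcongr
  have hDle : ∀ j, j < J → 1 ≤ j → D ≤ 1 / 2 := by
    intro j hj hj1
    refine le_trans ?_ (hJ1 j hj)
    have : (1 : ℝ) ≤ j := by exact_mod_cast hj1
    exact le_mul_of_one_le_right hD0 (one_le_pow₀ this)
  have hb : ∀ j, j < J → 1 ≤ j → 1 / 2 ≤ (1 - D) ^ (j ^ 2) := by
    intro j hj hj1
    have h2 := one_add_mul_le_pow (a := -D) (by linarith [hDle j hj hj1]) (j ^ 2)
    have h3 := hJ1 j hj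
    push_cast at h2
    rw [← sub_eq_add_neg] at h2
    linarith
  have key : ∀ j, j < J → (1 - D) ^ (j ^ 2) * g 0 ≤ g j ∧
      (1 - D) ^ (2 * j + 1) * g j ≤ g (j + 1) := by
    intro j
    induction j with
    | zero => intro _; simpa using h1
    | succ j ih =>
      intro hj
      obtain ⟨h2, h3⟩ := ih (by omega)
      have hD2 := hDle (j + 1) hj (by omega)
      have hp : 0 < 1 - D := by linarith
      have h4 : (1 - D) ^ ((j + 1) ^ 2) * g 0 ≤ g (j + 1) := by
        calc (1 - D) ^ ((j + 1) ^ 2) * g 0 = (1 - D) ^ (2 * j + 1) * ((1 - D) ^ (j ^ 2) * g 0) := by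
              rw [← mul_assoc, ← pow_add]; congr 2; ring
          _ ≤ (1 - D) ^ (2 * j + 1) * g j := by gcongr
          _ ≤ _ := h3
      have h5 : g 0 / 2 ≤ g (j + 1) := by
        have := mul_le_mul_of_nonneg_right (hb (j + 1) hj (by omega)) (by linarith : 0 ≤ g 0)
        linarith
      have h6 := hg j hj (by linarith)
      have hgj : 0 < g j := lt_of_lt_of_le (mul_pos (pow_pos hp _) (by linarith)) h2
      have hgj1 : 0 < g (j + 1) := by linarith
      refine ⟨h4, ?_⟩
      have h7 : (1 - D) ^ (2 * (j + 1) + 1) * g (j + 1) * g j ≤ g (j + 2) * g j := by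
        calc (1 - D) ^ (2 * (j + 1) + 1) * g (j + 1) * g j
            = (1 - D) ^ 2 * g (j + 1) * ((1 - D) ^ (2 * j + 1) * g j) := by ring
          _ ≤ (1 - D) ^ 2 * g (j + 1) * g (j + 1) := by gcongr
          _ = ((1 - D) * g (j + 1)) ^ 2 := by ring
          _ ≤ _ := h6
      exact le_of_mul_le_mul_right h7 hgj
  intro j hj
  rcases Nat.eq_zero_or_pos j with rfl | hj1
  · linarith
  · have := mul_le_mul_of_nonneg_right (hb j hj hj1) (by linarith : 0 ≤ g 0)
    linarith [(key j hj).1]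

/-- Almost log-convexity, for the bulk of the indices and long walks, of the number of walks that
visit `x` at a given index, as soon as this number is not too small. -/
theorem exists_almost_logConvex {o o' : Fin d} (h : o' ≠ o) :
    ∃ C : ℝ, 0 < C ∧ ∃ N : ℕ, ∀ k l : ℕ, N ≤ k + l + 4 → k + l + 4 ≤ 4 * (k + 2) →
      k + l + 4 ≤ 4 * (l + 2) → ∀ x : Fin d → ℤ,
      ((saws d (k + l + 4)).card : ℝ) / (k + l + 4 : ℕ) ≤ (pairs (k + 2) (l + 2) x).card →
      ((1 - C / (k + l + 4 : ℕ)) * (pairs (k + 2) (l + 2) x).card) ^ 2 ≤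
        ((pairs (k + 4) l x).card : ℝ) * (pairs k (l + 4) x).card := by
  obtain ⟨δ, ρ, K, hδ, hρ0, hρ1, hK, hbad⟩ := exists_card_badTriples_le h
  set c : ℝ := (moveConst d : ℝ) with hc
  have hc0 : 0 ≤ c := by positivity
  have hlim : Filter.Tendsto (fun n : ℕ => (n : ℝ) ^ 2 * ρ ^ n) Filter.atTop (nhds 0) :=
    tendsto_pow_const_mul_const_pow_of_lt_one 2 hρ0.le hρ1
  have hev : ∀ᶠ n : ℕ in Filter.atTop, (n : ℝ) ^ 2 * ρ ^ n < 1 / (2 * K) :=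
    hlim.eventually_lt_const (by positivity)
  obtain ⟨N₁, hN₁⟩ := Filter.eventually_atTop.1 hev
  obtain ⟨N₂, hN₂⟩ := exists_nat_ge (2 * c / δ + 1)
  refine ⟨2 * c / δ + 1, by positivity, max N₁ N₂, fun k l hN hk hl x hx => ?_⟩
  set n := k + l + 4 with hn
  have hn0 : (0 : ℝ) < n := by rw [hn]; positivity
  set a : ℝ := ((pairs (k + 2) (l + 2) x).card : ℝ) with ha
  have ha0 : 0 ≤ a := by positivity
  set M : ℝ := δ * n with hM
  have hM0 : 0 < M := by positivity
  have hsum : k + 2 + (l + 2) = n := by omega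
  refine le_trans ?_ (sq_card_goodPairs_le o hM0 k l x)
  set G : ℝ := ((goodPairs M (k + 2) (l + 2) x).card : ℝ) with hG
  have hcard : a ≤ G + 2 * K * ρ ^ n * (saws d n).card := by
    have h1 := card_pairs_le δ (k + 2) (l + 2) x
    rw [hsum] at h1
    have h2 := hbad 0 (k + 2) (l + 2) (by omega)
    have h3 := hbad (k + 2) (l + 2) 0 (by omega)
    rw [show 0 + (k + 2) + (l + 2) = n by omega] at h2
    rw [show k + 2 + (l + 2) + 0 = n by omega] at h3
    have h4 : a ≤ G + ((badTriples d δ 0 (k + 2) (l + 2)).card +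
        (badTriples d δ (k + 2) (l + 2) 0).card) := by
      rw [ha, hG]; exact_mod_cast h1
    have h5 : (ρ * connectiveConstant d) ^ n ≤ ρ ^ n * (saws d n).card := by
      rw [mul_pow]
      exact mul_le_mul_of_nonneg_left (connectiveConstant_pow_le o n) (by positivity)
    have h6 := mul_le_mul_of_nonneg_left h5 hK.le
    linarith
  have hsmall : 2 * K * ρ ^ n * (saws d n).card ≤ a / n := by
    have h1 := (hN₁ n ((le_max_left _ _).trans hN)).le
    rw [le_div_iff₀ (by positivity)] at h1
    have h2 : 2 * K * ρ ^ n * (saws d n).card * n ≤ ((saws d n).card : ℝ) / n := by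
      rw [le_div_iff₀ hn0]
      have := mul_le_mul_of_nonneg_right h1 (Nat.cast_nonneg (α := ℝ) (saws d n).card)
      linarith
    rw [le_div_iff₀ hn0]
    exact h2.trans hx
  have hG1 : (1 - 1 / n) * a ≤ G := by
    have : (1 - 1 / n) * a = a - a / n := by ring
    linarith
  have hnN : 2 * c / δ + 1 ≤ n := hN₂.trans (by exact_mod_cast (le_max_right _ _).trans hN)
  have hn1 : (1 : ℝ) ≤ n := by
    have : 0 ≤ 2 * c / δ := by positivity
    linarith
  have hMc : 1 - 2 * c / δ / n ≤ (M / (M + c)) ^ 2 := by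
    have h1 : 1 - c / M ≤ M / (M + c) := by
      rw [le_div_iff₀ (by positivity)]
      have : (1 - c / M) * (M + c) = M - c * c / M := by field_simp; ring
      rw [this]
      have : 0 ≤ c * c / M := by positivity
      linarith
    have h2 : 2 * c / δ / n = 2 * (c / M) := by rw [hM]; field_simp
    rw [h2]
    have h3 : 0 ≤ c / M := by positivity
    have h4 : 0 ≤ M / (M + c) := by positivity
    nlinarith [sq_nonneg (M / (M + c) - 1)]
  have hp : 0 ≤ 1 - (2 * c / δ + 1) / n := by
    rw [sub_nonneg, div_le_one hn0]
    exact hnN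
  refine pow_le_pow_left₀ (mul_nonneg hp ha0) ?_ 2
  have hs : 0 ≤ 1 - 1 / (n : ℝ) := by
    rw [sub_nonneg, div_le_one hn0]
    exact hn1
  calc (1 - (2 * c / δ + 1) / n) * a ≤ (1 - 2 * c / δ / n) * (1 - 1 / n) * a := by
        refine mul_le_mul_of_nonneg_right ?_ ha0
        have e : (2 * c / δ + 1) / (n : ℝ) = 2 * c / δ / n + 1 / n := by ring
        rw [e]
        have : 0 ≤ 2 * c / δ / n * (1 / n) := by positivity
        nlinarith
    _ ≤ (M / (M + c)) ^ 2 * (1 - 1 / n) * a := by gcongr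
    _ = (M / (M + c)) ^ 2 * ((1 - 1 / n) * a) := by ring
    _ ≤ _ := by gcongr

/-- The proportion of walks that are at a given point `x` halfway is at most of order `n ^ (-1/2)`:
otherwise walks visiting `x` at about `√n` other indices would be as numerous. -/
theorem exists_card_pairs_half_le {o o' : Fin d} (h : o' ≠ o) :
    ∃ C : ℝ, 0 < C ∧ ∀ n : ℕ, 1 ≤ n → ∀ x : Fin d → ℤ,
      ((pairs (n / 2) (n - n / 2) x).card : ℝ) ≤ C * (saws d n).card / √n := by
  obtain ⟨C₁, hC₁, N, hN⟩ := exists_almost_logConvex h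
  obtain ⟨N₂, hN₂⟩ := exists_nat_ge (2 * (C₁ + 1))
  set n₀ := max (max N N₂) 1000 with hn₀
  set C₂ := √(2 * (C₁ + 1)) with hC₂
  have hC₂0 : 0 < C₂ := Real.sqrt_pos.2 (by positivity)
  refine ⟨√n₀ + 2 + 4 * C₂, by positivity, fun n hn x => ?_⟩
  have hn0 : (0 : ℝ) < n := by exact_mod_cast hn
  have hsn : 0 < √(n : ℝ) := Real.sqrt_pos.2 hn0
  set A : ℕ → ℝ := fun k => ((pairs k (n - k) x).card : ℝ) with hA
  set cn : ℝ := ((saws d n).card : ℝ) with hcn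
  have hcn0 : 0 < cn := Nat.cast_pos.2 (saws_card_pos o n)
  have hAsum : ∑ k ∈ Finset.range (n + 1), A k ≤ cn := by
    simp only [hA, hcn]
    exact_mod_cast sum_card_pairs_le n x
  have hA0 : ∀ k, 0 ≤ A k := fun k => by positivity
  change A (n / 2) ≤ _
  have hAle : A (n / 2) ≤ cn := le_trans
    (Finset.single_le_sum (fun k _ => hA0 k) (Finset.mem_range.2 (by omega))) hAsum
  rw [le_div_iff₀ hsn]
  rcases lt_or_ge n n₀ with hlt | hge
  · -- short walks: the trivial bound
    have h1 : √(n : ℝ) ≤ √n₀ := Real.sqrt_le_sqrt (by exact_mod_cast hlt.le)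
    calc A (n / 2) * √n ≤ cn * √n₀ := by gcongr
      _ ≤ (√n₀ + 2 + 4 * C₂) * cn := by nlinarith
  have hnN : N ≤ n := ((le_max_left _ _).trans (le_max_left _ _)).trans hge
  have hnN₂ : 2 * (C₁ + 1) ≤ n :=
    hN₂.trans (by exact_mod_cast ((le_max_right _ _).trans (le_max_left _ _)).trans hge)
  have hn1000 : 1000 ≤ n := (le_max_right _ _).trans hge
  rcases lt_or_ge (A (n / 2)) (2 * (cn / n)) with hsmall | hbig
  · have h1 : A (n / 2) * √n ≤ 2 * cn := by
      have h2 : √(n : ℝ) ≤ n := by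
        rw [Real.sqrt_le_left (by positivity)]
        have : (1 : ℝ) ≤ n := by exact_mod_cast hn
        nlinarith
      calc A (n / 2) * √n ≤ 2 * (cn / n) * n := by gcongr
        _ = 2 * cn := by field_simp
    have : 0 ≤ √(n₀ : ℝ) * cn := by positivity
    have : 0 ≤ 4 * C₂ * cn := by positivity
    linarith
  have hconv : ∀ m : ℕ, 2 ≤ m → m + 2 ≤ n → n ≤ 4 * m → n ≤ 4 * (n - m) → cn / n ≤ A m →
      ((1 - C₁ / n) * A m) ^ 2 ≤ A (m + 2) * A (m - 2) := by
    intro m h1 h2 h3 h4 h5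
    obtain ⟨k, rfl⟩ := Nat.exists_eq_add_of_le' h1
    obtain ⟨l, hl⟩ := Nat.exists_eq_add_of_le' h2
    have hkl : k + l + 4 = n := by omega
    have e1 : n - (k + 2) = l + 2 := by omega
    have e2 : n - (k + 2 + 2) = l := by omega
    have e3 : n - (k + 2 - 2) = l + 4 := by omega
    have h6 := hN k l (by omega) (by omega) (by omega) x
    rw [hkl] at h6
    simp only [hA, e1, e2, e3] at h5 ⊢
    exact h6 h5
  -- the visiting index can be spread over `J` values
  set y : ℝ := √(n / (2 * (C₁ + 1))) with hy
  set J := ⌊y⌋₊ with hJ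
  have hy1 : 1 ≤ y := by
    rw [hy, Real.one_le_sqrt, one_le_div (by positivity)]
    exact hnN₂
  have hJy : (J : ℝ) ≤ y := Nat.floor_le (by positivity)
  have hJ1 : 1 ≤ J := Nat.le_floor (by simpa using hy1)
  have hJ2 : y / 2 ≤ J := by
    have h1 : y < J + 1 := Nat.lt_floor_add_one y
    have h2 : (1 : ℝ) ≤ J := by exact_mod_cast hJ1
    linarith
  have hy2 : y ^ 2 = n / (2 * (C₁ + 1)) := Real.sq_sqrt (by positivity)
  have hJsq : (J : ℝ) ^ 2 ≤ n / (2 * (C₁ + 1)) := by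
    rw [← hy2]
    gcongr
  have hD : C₁ / n * (J : ℝ) ^ 2 ≤ 1 / 2 := by
    calc C₁ / n * (J : ℝ) ^ 2 ≤ C₁ / n * (n / (2 * (C₁ + 1))) := by gcongr
      _ = C₁ / (C₁ + 1) / 2 := by field_simp
      _ ≤ 1 / 2 := by
        have : C₁ / (C₁ + 1) ≤ 1 := (div_le_one (by positivity)).2 (by linarith)
        linarith
  have hJn : 8 * J + 16 ≤ n := by
    have h1 : (J : ℝ) ^ 2 ≤ n := by
      refine hJsq.trans (div_le_self hn0.le (by linarith))
    have h2 : J ^ 2 ≤ n := by exact_mod_cast h1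
    by_contra hcon
    push Not at hcon
    nlinarith
  have hτ : 0 < cn / n := by positivity
  have hfin : ∀ e : ℕ → ℕ, Set.InjOn e (Finset.range J) → (∀ j < J, e j < n + 1) →
      (∀ j < J, A (n / 2) / 2 ≤ A (e j)) → A (n / 2) * √n ≤ 4 * C₂ * cn := by
    intro e he1 he2 he3
    have h1 : J * (A (n / 2) / 2) ≤ cn := by
      calc J * (A (n / 2) / 2) = ∑ j ∈ Finset.range J, A (n / 2) / 2 := by simp
        _ ≤ ∑ j ∈ Finset.range J, A (e j) :=
          Finset.sum_le_sum fun j hj => he3 j (Finset.mem_range.1 hj)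
        _ = ∑ k ∈ (Finset.range J).image e, A k := (Finset.sum_image he1).symm
        _ ≤ ∑ k ∈ Finset.range (n + 1), A k := by
          refine Finset.sum_le_sum_of_subset_of_nonneg ?_ fun k _ _ => hA0 k
          intro k hk
          obtain ⟨j, hj, rfl⟩ := Finset.mem_image.1 hk
          exact Finset.mem_range.2 (he2 j (Finset.mem_range.1 hj))
        _ ≤ cn := hAsum
    have h2 : y * C₂ = √n := by
      rw [hy, hC₂, ← Real.sqrt_mul (by positivity)]
      congr 1
      field_simp
    have h3 : y / 2 * (A (n / 2) / 2) ≤ cn :=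
      (mul_le_mul_of_nonneg_right hJ2 (by linarith [hA0 (n / 2)])).trans h1
    calc A (n / 2) * √n = 4 * C₂ * (y / 2 * (A (n / 2) / 2)) := by rw [← h2]; ring
      _ ≤ 4 * C₂ * cn := by gcongr
  have hgoal : A (n / 2) * √n ≤ 4 * C₂ * cn := by
    have hDn : 0 ≤ 1 - C₁ / n := by
      rw [sub_nonneg, div_le_one hn0]
      linarith
    have hstep : (1 - C₁ / n) * A (n / 2) ≤ A (n / 2 + 2) ∨
        (1 - C₁ / n) * A (n / 2) ≤ A (n / 2 - 2) := by
      by_contra hcon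
      push Not at hcon
      have h1 := hconv (n / 2) (by omega) (by omega) (by omega) (by omega) (by linarith)
      have h2 := mul_lt_mul'' hcon.1 hcon.2 (hA0 _) (hA0 _)
      nlinarith
    rcases hstep with hs | hs
    · refine hfin (fun j => n / 2 + 2 * j) (fun a _ b _ hab => by simpa using hab)
        (fun j hj => by omega) ?_
      refine half_le_of_almost_logConvex (g := fun j => A (n / 2 + 2 * j)) (by positivity) hD hτ
        hbig hs fun j hj hj2 => ?_
      exact hconv (n / 2 + 2 * (j + 1)) (by omega) (by omega) (by omega) (by omega) hj2
    · refine hfin (fun j => n / 2 - 2 * j) ?_ (fun j hj => by omega) ?_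
      · intro a ha b hb hab
        simp only [Finset.coe_range, Set.mem_Iio] at ha hb hab
        omega
      refine half_le_of_almost_logConvex (g := fun j => A (n / 2 - 2 * j)) (by positivity) hD hτ
        hbig hs fun j hj hj2 => ?_
      have h1 := hconv (n / 2 - 2 * (j + 1)) (by omega) (by omega) (by omega) (by omega) hj2
      rw [show n / 2 - 2 * (j + 1) + 2 = n / 2 - 2 * j by omega,
        show n / 2 - 2 * (j + 1) - 2 = n / 2 - 2 * (j + 2) by omega, mul_comm (A _)] at h1
      exact h1
  have : 0 ≤ √(n₀ : ℝ) * cn := by positivity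
  linarith

/-! ### From words to walks -/

/-- The walk from `0` whose steps are the letters of the word `w`. -/
def toWalk (n : ℕ) (w : List (Step d)) : Fin (n + 1) → Fin d → ℤ := fun i => disp (w.take i)

theorem verts_eq_ofFn (x : Fin d → ℤ) (w : List (Step d)) :
    verts x w = List.ofFn fun i : Fin (w.length + 1) => x + disp (w.take i) := by
  induction w generalizing x with
  | nil => simp
  | cons s w ih =>
    rw [verts_cons, ih, List.length_cons, List.ofFn_succ (n := w.length + 1)]
    simp [add_assoc]

theorem injective_toWalk_iff {n : ℕ} {w : List (Step d)} (hw : w.length = n) :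
    Function.Injective (toWalk n w) ↔ IsSAW w := by
  subst hw
  rw [IsSAW, verts_eq_ofFn, List.nodup_ofFn]
  simp only [zero_add]
  rfl

theorem adj_iff_exists_step {x y : Fin d → ℤ} :
    (lattice d).Adj x y ↔ ∃ s : Step d, y = x + vec s := by
  constructor
  · intro h
    have h1 : ∑ i, |x i - y i| = 1 := h
    obtain ⟨i, -, hi⟩ : ∃ i ∈ Finset.univ, |x i - y i| ≠ 0 :=
      Finset.exists_ne_zero_of_sum_ne_zero (by rw [h1]; exact one_ne_zero)
    rw [← Finset.add_sum_erase _ _ (Finset.mem_univ i)] at h1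
    have h2 : 0 ≤ ∑ j ∈ Finset.univ.erase i, |x j - y j| :=
      Finset.sum_nonneg fun j _ => abs_nonneg _
    have h3 : 0 < |x i - y i| := lt_of_le_of_ne (abs_nonneg _) hi.symm
    have h4 : ∑ j ∈ Finset.univ.erase i, |x j - y j| = 0 := by omega
    have h5 : |x i - y i| = 1 := by omega
    have h6 : ∀ j, j ≠ i → x j = y j := by
      intro j hj
      have := (Finset.sum_eq_zero_iff_of_nonneg fun j _ => abs_nonneg (x j - y j)).1 h4 j
        (Finset.mem_erase.2 ⟨hj, Finset.mem_univ j⟩)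
      rw [abs_eq_zero] at this
      omega
    rcases (abs_eq zero_le_one).1 h5 with h7 | h7
    · refine ⟨(i, -1), funext fun j => ?_⟩
      rcases eq_or_ne j i with rfl | hj
      · simp [vec]; omega
      · simp [vec, hj, h6 j hj]
    · refine ⟨(i, 1), funext fun j => ?_⟩
      rcases eq_or_ne j i with rfl | hj
      · simp [vec]; omega
      · simp [vec, hj, h6 j hj]
  · rintro ⟨⟨i, e⟩, rfl⟩
    change ∑ j, |x j - (x + vec (i, e)) j| = 1
    rw [Finset.sum_eq_single i]
    · rcases Int.units_eq_one_or e with rfl | rfl <;> simp [vec]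
    · intro j _ hj
      simp [vec, hj]
    · simp

theorem toWalk_succ {n : ℕ} {w : List (Step d)} (hw : w.length = n) (i : Fin n) :
    toWalk n w i.succ = toWalk n w i.castSucc + vec (w[i.1]'(by omega)) := by
  simp only [toWalk, Fin.val_succ, Fin.val_castSucc]
  rw [List.take_succ_eq_append_getElem (by omega), disp_append]
  simp

theorem toWalk_image (d n : ℕ) : toWalk n '' (saws d n : Set (List (Step d))) = SAW d n := by
  ext γ
  constructor
  · rintro ⟨w, hw, rfl⟩
    obtain ⟨h1, h2⟩ := mem_saws.1 hw
    exact ⟨by simp [toWalk], fun i => adj_iff_exists_step.2 ⟨_, toWalk_succ h1 i⟩,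
      (injective_toWalk_iff h1).2 h2⟩
  · rintro ⟨h0, h1, h2⟩
    choose s hs using fun i => adj_iff_exists_step.1 (h1 i)
    have hlen : (List.ofFn s).length = n := List.length_ofFn
    have hγ : toWalk n (List.ofFn s) = γ := by
      funext i
      induction i using Fin.induction with
      | zero => simp [toWalk, h0]
      | succ i ih => rw [toWalk_succ hlen, ih, hs]; simp
    refine ⟨List.ofFn s, mem_saws.2 ⟨hlen, (injective_toWalk_iff hlen).1 (by rwa [hγ])⟩, hγ⟩

theorem toWalk_injOn (d n : ℕ) : Set.InjOn (toWalk n) (saws d n : Set (List (Step d))) := by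
  intro a ha b hb hab
  obtain ⟨h1, -⟩ := mem_saws.1 ha
  obtain ⟨h2, -⟩ := mem_saws.1 hb
  refine List.ext_getElem (by omega) fun i hi1 hi2 => ?_
  have h3 := toWalk_succ h1 ⟨i, by omega⟩
  rw [hab, toWalk_succ h2 ⟨i, by omega⟩] at h3
  exact (vec_injective (add_left_cancel h3)).symm

theorem PSAW_visit_le {n k : ℕ} (hk : k < n + 1) (x : Fin d → ℤ) :
    PSAW d n {Γ | Γ ⟨k, hk⟩ = x} ≤
      ((saws d n).card : ENNReal)⁻¹ * ((pairs k (n - k) x).card : ENNReal) := by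
  rw [PSAW, uniformOn, cond_apply (finite_SAW d n).measurableSet,
    Measure.count_apply (finite_SAW d n).measurableSet,
    Measure.count_apply ((finite_SAW d n).inter_of_left _).measurableSet]
  have h1 : (SAW d n).encard = ((saws d n).card : ℕ∞) := by
    rw [← toWalk_image, (toWalk_injOn d n).encard_image, Set.encard_coe_eq_coe_finsetCard]
  have h2 : (SAW d n ∩ {Γ | Γ ⟨k, hk⟩ = x}).encard ≤ ((pairs k (n - k) x).card : ℕ∞) := by
    have hsub : SAW d n ∩ {Γ | Γ ⟨k, hk⟩ = x} ⊆
        (fun y : List (Step d) × List (Step d) => toWalk n (y.1 ++ y.2)) ''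
          (pairs k (n - k) x : Set (List (Step d) × List (Step d))) := by
      rintro γ ⟨h3, h4⟩
      rw [← toWalk_image] at h3
      obtain ⟨w, hw, rfl⟩ := h3
      obtain ⟨h5, h6⟩ := mem_saws.1 hw
      refine ⟨(w.take k, w.drop k), mem_pairs.2 ⟨?_, ?_, ?_, h4⟩, ?_⟩
      · rw [List.length_take]; omega
      · rw [List.length_drop, h5]
      · simpa using h6
      · simp
    refine (Set.encard_le_encard hsub).trans ((Set.encard_image_le _ _).trans ?_)
    rw [Set.encard_coe_eq_coe_finsetCard]
  rw [h1]
  gcongr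
  · simp
  · exact_mod_cast h2

end SelfAvoidingWalk

theorem proposition1p3 (d : ℕ) (hd : 2 ≤ d) :
    ∃ C : ℝ, 0 < C ∧ ∀ n : ℕ, 1 ≤ n →
      (⨆ x : Fin d → ℤ,
          SelfAvoidingWalk.PSAW d n
            {Γ : Fin (n + 1) → Fin d → ℤ |
              Γ ⟨n / 2, Nat.lt_succ_of_le (Nat.div_le_self n 2)⟩ = x}) ≤
        ENNReal.ofReal (C * (n : ℝ) ^ (-(1 / 2) : ℝ)) := by
  have hne : (⟨1, by omega⟩ : Fin d) ≠ ⟨0, by omega⟩ := by simp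
  obtain ⟨C, hC, h⟩ := SelfAvoidingWalk.exists_card_pairs_half_le hne
  refine ⟨C, hC, fun n hn => iSup_le fun x => ?_⟩
  refine (SelfAvoidingWalk.PSAW_visit_le _ x).trans ?_
  have hc : (0 : ℝ) < (SelfAvoidingWalk.saws d n).card := by
    exact_mod_cast SelfAvoidingWalk.saws_card_pos ⟨0, by omega⟩ n
  rw [← ENNReal.ofReal_natCast, ← ENNReal.ofReal_natCast, ← ENNReal.ofReal_inv_of_pos hc,
    ← ENNReal.ofReal_mul (by positivity)]
  refine ENNReal.ofReal_le_ofReal ?_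
  rw [Real.rpow_neg (Nat.cast_nonneg n), ← Real.sqrt_eq_rpow, inv_mul_le_iff₀ hc]
  refine (h n hn x).trans (le_of_eq ?_)
  rw [div_eq_mul_inv]
  ring
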